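/- Let $B$ be a compact Hausdorff space and let $X$ be a (finite-dimensional, Hausdorff, second countable) smooth manifold with possibly empty boundary $\partial X$; $X$ need not be compact. Give $\operatorname{Diff}(X)$ the topology of uniform convergence of all derivatives on compact sets. Let $\pi:\mathcal X\to B$ be a manifold over $B$ with fibre $X$, i.e. a fibre bundle with fibre $X$ and structure group $\operatorname{Diff}(X)$ (diffeomorphisms automatically preserve $\partial X$), so that the transition functions of the local trivializations are continuous maps into $\operatorname{Diff}(X)$. Let $\mathcal M=\partial_B\mathcal X\subset\mathcal X$ be its boundary over $B$, i.e. the sub-bundle with fibre $\partial X$, a manifold over $B$ whose local trivializations are the restrictions of those of $\mathcal X$. Write $\mathbb R^{m+1}_+$ for the closed half-space in $\mathbb R^{m+1}$ bounded by $\mathbb R^m=\partial\mathbb R^{m+1}_+$. Then there are an integer $m\ge 0$ and a map $$h:\mathcal X\to B\times\mathbb R^{m+1}_+$$ that is a neat embedding of manifolds over $B$: $h$ commutes with the projections to $B$; in every local trivialization of $\mathcal X$ it is given by smooth maps $X\to\mathbb R^{m+1}_+$ depending continuously on $b\in B$ in the topology of uniform convergence of all derivatives on compact sets; $h$ is a homeomorphism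 onto its image; and for every $b\in B$ the restriction $h_b:\mathcal X_b\to\mathbb R^{m+1}_+$ to the fibre is a neat embedding, i.e. a smooth embedding (an immersion that is a homeomorphism onto its image) with $h_b^{-1}(\mathbb R^m)=\partial\mathcal X_b$ and $dh_b(T_x\mathcal X_b)+T_{h_b(x)}\mathbb R^m=\mathbb R^{m+1}$ for all $x\in\partial\mathcal X_b$. Moreover $h$ restricts to a map $\mathcal M\to B\times\mathbb R^m$ that is an embedding of manifolds over $B$: it is likewise a continuous family of smooth maps over $B$ and a homeomorphism onto its image, and it restricts to a smooth embedding $\mathcal M_b=\partial\mathcal X_b\to\mathbb R^m$ for every $b\in B$. -/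

import Mathlib

open Set Function Topology Bundle
open scoped Manifold ContDiff

noncomputable section

/-! ### The weak (compact-open) `C^∞` topology -/

section WeakTopology

variable {E : Type*} [NormedAddCommGroup E] [NormedSpace ℝ E]
  {H : Type*} [TopologicalSpace H] {I : ModelWithCorners ℝ E H}
  {X : Type*} [TopologicalSpace X] [ChartedSpace H X]
  {F : Type*} [NormedAddCommGroup F] [NormedSpace ℝ F]
  {G : Type*} [TopologicalSpace G] {J : ModelWithCorners ℝ F G}
  {Y : Type*} [TopologicalSpace Y] [ChartedSpace G Y]

/-- The smooth maps `g : X → Y` that map `K` into the domain of the chart `ψ` and whose derivatives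
up to order `r`, read in the charts `φ` and `ψ`, are `ε`-close to those of `f` on `K`. -/
def weakSmoothNhd (f : C^∞⟮I, X; J, Y⟯) (φ : OpenPartialHomeomorph X H)
    (ψ : OpenPartialHomeomorph Y G) (K : Set X) (r : ℕ) (ε : ℝ) : Set C^∞⟮I, X; J, Y⟯ :=
  {g | MapsTo g K ψ.source ∧ ∀ k ≤ r, ∀ x ∈ K,
    ‖iteratedFDerivWithin ℝ k (ψ.extend J ∘ f ∘ (φ.extend I).symm) (range I) (φ.extend I x) -
      iteratedFDerivWithin ℝ k (ψ.extend J ∘ g ∘ (φ.extend I).symm) (range I) (φ.extend I x)‖ < ε}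

/-- The weak `C^∞` topology (uniform convergence of all derivatives on compact sets) on the space
of smooth maps. -/
instance weakSmoothTopology : TopologicalSpace C^∞⟮I, X; J, Y⟯ :=
  TopologicalSpace.generateFrom {S | ∃ (f : C^∞⟮I, X; J, Y⟯) (φ : OpenPartialHomeomorph X H)
    (ψ : OpenPartialHomeomorph Y G) (K : Set X) (r : ℕ) (ε : ℝ),
    φ ∈ atlas H X ∧ ψ ∈ atlas G Y ∧ IsCompact K ∧ K ⊆ φ.source ∧ MapsTo f K ψ.source ∧ 0 < ε ∧
      S = weakSmoothNhd f φ ψ K r ε}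

/-- The topology of the diffeomorphism group: uniform convergence of all derivatives on compact
sets. -/
instance diffeomorphTopology : TopologicalSpace (X ≃ₘ⟮I, J⟯ Y) :=
  TopologicalSpace.induced (fun g => (g : C^∞⟮I, X; J, Y⟯)) weakSmoothTopology

end WeakTopology

/-! ### Models for manifolds with boundary, and the smooth structure of the boundary -/

/-- A model for manifolds with (possibly empty) boundary: its range is the half-space `{0 ≤ ℓ}` of
a linear form `ℓ`. The form `ℓ = 0` is allowed and gives the whole space, i.e. the model for
manifolds without boundary. -/
class HalfSpaceModel {E : Type*} [NormedAddCommGroup E] [NormedSpace ℝ E]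
    {H : Type*} [TopologicalSpace H] (I : ModelWithCorners ℝ E H) where
  /-- the linear form -/
  form : E →L[ℝ] ℝ
  range_eq : range I = {v | 0 ≤ form v}

/-- The Euclidean half-space `{x | 0 ≤ x 0}`. -/
instance halfSpaceModelEuclideanHalfSpace (n : ℕ) [NeZero n] : HalfSpaceModel (𝓡∂ n) where
  form := EuclideanSpace.proj 0
  range_eq := by
    rw [range_modelWithCornersEuclideanHalfSpace]
    rfl

/-- Manifolds without boundary. -/
instance halfSpaceModelSelf (E : Type*) [NormedAddCommGroup E] [NormedSpace ℝ E] :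
    HalfSpaceModel 𝓘(ℝ, E) where
  form := 0
  range_eq := by simp

section Boundary

variable {E : Type*} [NormedAddCommGroup E] [NormedSpace ℝ E]
  {H : Type*} [TopologicalSpace H] (I : ModelWithCorners ℝ E H) [HalfSpaceModel I]

/-- The model space of the boundary, which is also the tangent space of the boundary inside the
tangent space of the manifold, read in a chart. -/
abbrev BoundaryModel : Submodule ℝ E := LinearMap.ker (HalfSpaceModel.form I : E →ₗ[ℝ] ℝ)

variable {X : Type*} [TopologicalSpace X] [ChartedSpace H X]

variable {I} in
lemma form_ne_zero_of_mem_boundary {x : X} (hx : x ∈ I.boundary X) :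
    HalfSpaceModel.form I ≠ 0 := by
  intro h
  have h1 : range I = univ := by rw [HalfSpaceModel.range_eq, h]; simp
  have h2 : extChartAt I x x ∈ frontier (range I) := hx
  rw [h1, frontier_univ] at h2
  exact h2

variable [IsManifold I ∞ X]

variable {I} in
lemma mem_boundary_iff_form (h0 : HalfSpaceModel.form I ≠ 0) {φ : OpenPartialHomeomorph X H}
    (hφ : φ ∈ atlas H X) {y : X} (hy : y ∈ φ.source) :
    y ∈ I.boundary X ↔ HalfSpaceModel.form I (φ.extend I y) = 0 := by
  have hsurj : IsOpenMap (HalfSpaceModel.form I) :=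
    (HalfSpaceModel.form I).isOpenMap_of_ne_zero h0
  have hint : interior (range I) = {v | 0 < HalfSpaceModel.form I v} := by
    rw [HalfSpaceModel.range_eq (I := I)]
    have := hsurj.preimage_interior_eq_interior_preimage (HalfSpaceModel.form I).continuous (Ici 0)
    rw [interior_Ici] at this
    exact this.symm
  have hmem : φ.extend I y ∈ range I := by simp
  have hpre : φ.extend I y ∈ I.symm ⁻¹' φ.target := by simp [hy]
  have h1 : y ∈ I.boundary X ↔ ¬ I.IsInteriorPoint y := by
    rw [← I.isBoundaryPoint_iff_not_isInteriorPoint]; rfl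
  rw [h1, I.isInteriorPoint_iff_of_mem_atlas (n := ∞) (by simp) hφ hy,
    OpenPartialHomeomorph.extend_target, interior_inter,
    (φ.open_target.preimage I.continuous_symm).interior_eq, hint]
  rw [HalfSpaceModel.range_eq (I := I)] at hmem
  have hmem' : 0 ≤ HalfSpaceModel.form I (φ.extend I y) := hmem
  constructor
  · intro h
    by_contra h'
    exact h ⟨hpre, lt_of_le_of_ne hmem' (Ne.symm h')⟩
  · rintro h ⟨-, h'⟩
    exact absurd h (ne_of_gt h')

variable {I} in
lemma mem_boundary_iff_extChartAt (x₀ : I.boundary X) {y : X}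
    (hy : y ∈ (extChartAt I x₀.1).source) :
    y ∈ I.boundary X ↔ HalfSpaceModel.form I (extChartAt I x₀.1 y) = 0 :=
  mem_boundary_iff_form (form_ne_zero_of_mem_boundary x₀.2) (chart_mem_atlas H x₀.1)
    (by simpa using hy)

variable {I} in
lemma extChartAt_symm_mem_boundary (x₀ : I.boundary X) (v : BoundaryModel I)
    (hv : (v : E) ∈ (extChartAt I x₀.1).target) :
    (extChartAt I x₀.1).symm v ∈ I.boundary X := by
  rw [mem_boundary_iff_extChartAt x₀ ((extChartAt I x₀.1).map_target hv),
    (extChartAt I x₀.1).right_inv hv]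
  exact v.2

section Proj

variable {E : Type*} [NormedAddCommGroup E] [NormedSpace ℝ E] [FiniteDimensional ℝ E]
  {H : Type*} [TopologicalSpace H] (I : ModelWithCorners ℝ E H) [HalfSpaceModel I]

lemma exists_boundaryProj : ∃ P : E →L[ℝ] BoundaryModel I, ∀ v : BoundaryModel I, P v = v :=
  Submodule.ClosedComplemented.of_finiteDimensional_quotient
    (ContinuousLinearMap.isClosed_ker (HalfSpaceModel.form I))

/-- A linear projection onto the model space of the boundary. -/
def boundaryProj : E →L[ℝ] BoundaryModel I := (exists_boundaryProj I).choose

lemma boundaryProj_coe (v : BoundaryModel I) : boundaryProj I v = v :=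
  (exists_boundaryProj I).choose_spec v

lemma boundaryProj_of_mem {v : E} (hv : HalfSpaceModel.form I v = 0) :
    (boundaryProj I v : E) = v :=
  congrArg Subtype.val (boundaryProj_coe I ⟨v, hv⟩)

end Proj

variable [FiniteDimensional ℝ E]

variable {I} in
lemma boundaryProj_extChartAt (x₀ y : I.boundary X) (hy : y.1 ∈ (extChartAt I x₀.1).source) :
    (boundaryProj I (extChartAt I x₀.1 y) : E) = extChartAt I x₀.1 y :=
  boundaryProj_of_mem I ((mem_boundary_iff_extChartAt x₀ hy).1 y.2)

open Classical in
/-- The chart of the boundary induced by the preferred chart of the manifold at a boundary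
point. -/
def boundaryChart (x₀ : I.boundary X) :
    OpenPartialHomeomorph (I.boundary X) (BoundaryModel I) where
  toFun y := boundaryProj I (extChartAt I x₀.1 y)
  invFun v := if h : (extChartAt I x₀.1).symm v ∈ I.boundary X then ⟨_, h⟩ else x₀
  source := Subtype.val ⁻¹' (extChartAt I x₀.1).source
  target := Subtype.val ⁻¹' (extChartAt I x₀.1).target
  map_source' y hy := by
    have := (extChartAt I x₀.1).map_source hy
    rwa [← boundaryProj_extChartAt x₀ y hy] at this
  map_target' v hv := by
    rw [dif_pos (extChartAt_symm_mem_boundary x₀ v hv)]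
    exact (extChartAt I x₀.1).map_target hv
  left_inv' y hy := by
    have h1 : (extChartAt I x₀.1).symm (boundaryProj I (extChartAt I x₀.1 y)) = y := by
      rw [boundaryProj_extChartAt x₀ y hy, (extChartAt I x₀.1).left_inv hy]
    have h2 : (extChartAt I x₀.1).symm (boundaryProj I (extChartAt I x₀.1 y)) ∈ I.boundary X := by
      rw [h1]; exact y.2
    rw [dif_pos h2]
    exact Subtype.ext h1
  right_inv' v hv := by
    rw [dif_pos (extChartAt_symm_mem_boundary x₀ v hv)]
    apply Subtype.ext
    show (boundaryProj I (extChartAt I x₀.1 ((extChartAt I x₀.1).symm v)) : E) = v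
    rw [(extChartAt I x₀.1).right_inv hv, boundaryProj_coe]
  open_source := (isOpen_extChartAt_source x₀.1).preimage continuous_subtype_val
  open_target := by
    have h : (Subtype.val ⁻¹' (extChartAt I x₀.1).target : Set (BoundaryModel I)) =
        Subtype.val ⁻¹' (I.symm ⁻¹' (chartAt H x₀.1).target) := by
      ext v
      have hv : (v : E) ∈ range I := by
        rw [HalfSpaceModel.range_eq (I := I)]
        exact ge_of_eq v.2
      simp only [mem_preimage, extChartAt_target, mem_inter_iff, hv, and_true]
    rw [h]
    exact ((chartAt H x₀.1).open_target.preimage I.continuous_symm).preimage continuous_subtype_val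
  continuousOn_toFun := (boundaryProj I).continuous.comp_continuousOn
    ((continuousOn_extChartAt x₀.1).comp continuous_subtype_val.continuousOn fun _ hy => hy)
  continuousOn_invFun := by
    rw [IsInducing.subtypeVal.continuousOn_iff]
    refine ((continuousOn_extChartAt_symm x₀.1).comp continuous_subtype_val.continuousOn
      fun _ hy => hy).congr fun v hv => ?_
    show ((if h : (extChartAt I x₀.1).symm v ∈ I.boundary X then ⟨_, h⟩ else x₀ :
      I.boundary X) : X) = _
    rw [dif_pos (extChartAt_symm_mem_boundary x₀ v hv)]
    rfl

variable {I} in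
lemma boundaryChart_apply (x₀ y : I.boundary X) :
    boundaryChart I x₀ y = boundaryProj I (extChartAt I x₀.1 y) := rfl

variable {I} in
lemma boundaryChart_symm_coe (x₀ : I.boundary X) {v : BoundaryModel I}
    (hv : (v : E) ∈ (extChartAt I x₀.1).target) :
    ((boundaryChart I x₀).symm v : X) = (extChartAt I x₀.1).symm v := by
  have h : (boundaryChart I x₀).symm v = ⟨_, extChartAt_symm_mem_boundary x₀ v hv⟩ :=
    dif_pos (extChartAt_symm_mem_boundary x₀ v hv)
  rw [h]

/-- The boundary of a manifold with boundary, as a manifold: its charts are the restrictions of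
the charts of the manifold. -/
instance boundaryChartedSpace : ChartedSpace (BoundaryModel I) (I.boundary X) where
  atlas := range (boundaryChart I)
  chartAt := boundaryChart I
  mem_chart_source x := mem_extChartAt_source x.1
  chart_mem_atlas x := mem_range_self x

instance boundaryIsManifold : IsManifold 𝓘(ℝ, BoundaryModel I) ∞ (I.boundary X) := by
  apply isManifold_of_contDiffOn
  rintro _ _ ⟨x, rfl⟩ ⟨y, rfl⟩
  have h1 : ContDiffOn ℝ ∞ (extChartAt I y.1 ∘ (extChartAt I x.1).symm)
      ((extChartAt I x.1).symm ≫ extChartAt I y.1).source :=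
    contDiffOn_ext_coord_change y.1 x.1
  have h2 := (boundaryProj I).contDiff.comp_contDiffOn
    (h1.comp (BoundaryModel I).subtypeL.contDiff.contDiffOn (fun v hv => hv))
  have h3 : ∀ v : BoundaryModel I, v ∈ ((boundaryChart I x).symm ≫ₕ boundaryChart I y).source →
      (v : E) ∈ (extChartAt I x.1).target ∧
        (extChartAt I x.1).symm v ∈ (extChartAt I y.1).source := by
    intro v hv
    have hv1 : (v : E) ∈ (extChartAt I x.1).target := hv.1
    refine ⟨hv1, ?_⟩
    rw [← boundaryChart_symm_coe x hv1]
    exact hv.2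
  refine (h2.mono ?_).congr ?_
  · rintro v ⟨hv, -⟩
    exact h3 v hv
  · rintro v ⟨hv, -⟩
    show boundaryProj I (extChartAt I y.1 ((boundaryChart I x).symm v).1) = _
    rw [boundaryChart_symm_coe x (h3 v hv).1]
    rfl

variable {I}

/-- The inclusion of the boundary is smooth. -/
lemma contMDiff_boundary_val :
    ContMDiff 𝓘(ℝ, BoundaryModel I) I ∞ (Subtype.val : I.boundary X → X) := by
  intro x
  rw [contMDiffAt_iff_source]
  have hx : boundaryChart I x x ∈ (boundaryChart I x).target :=
    (boundaryChart I x).map_source (mem_chart_source (BoundaryModel I) x)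
  have h1 : ContMDiffOn 𝓘(ℝ, BoundaryModel I) I ∞
      ((extChartAt I x.1).symm ∘ (BoundaryModel I).subtypeL) (boundaryChart I x).target :=
    (contMDiffOn_extChartAt_symm x.1).comp
      (BoundaryModel I).subtypeL.contDiff.contMDiff.contMDiffOn fun v hv => hv
  have h2 : ContMDiffOn 𝓘(ℝ, BoundaryModel I) I ∞
      (Subtype.val ∘ (boundaryChart I x).symm) (boundaryChart I x).target :=
    h1.congr fun v hv => boundaryChart_symm_coe x hv
  exact (h2.contMDiffAt ((boundaryChart I x).open_target.mem_nhds hx)).contMDiffWithinAt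

/-- A map into the boundary is smooth if it is smooth as a map into the manifold. -/
lemma contMDiff_boundary_of_val {F : Type*} [NormedAddCommGroup F] [NormedSpace ℝ F]
    {G : Type*} [TopologicalSpace G] {J : ModelWithCorners ℝ F G}
    {Y : Type*} [TopologicalSpace Y] [ChartedSpace G Y] {f : Y → I.boundary X}
    (hf : ContMDiff J I ∞ (fun y => (f y : X))) :
    ContMDiff J 𝓘(ℝ, BoundaryModel I) ∞ f := by
  intro y
  rw [contMDiffAt_iff_target]
  refine ⟨(continuous_induced_rng.2 hf.continuous).continuousAt, ?_⟩
  exact (boundaryProj I).contMDiff.contMDiffAt.comp y ((contMDiffAt_extChartAt).comp y (hf y))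

/-- The restriction of a diffeomorphism to the boundaries. -/
def boundaryDiffeomorph (g : X ≃ₘ⟮I, I⟯ X) :
    I.boundary X ≃ₘ⟮𝓘(ℝ, BoundaryModel I), 𝓘(ℝ, BoundaryModel I)⟯ I.boundary X where
  toFun x := ⟨g x, by
    have h : (x : X) ∈ g ⁻¹' I.boundary X := by
      rw [g.preimage_boundary (by simp)]; exact x.2
    exact h⟩
  invFun x := ⟨g.symm x, by
    have h : (x : X) ∈ g.symm ⁻¹' I.boundary X := by
      rw [g.symm.preimage_boundary (by simp)]; exact x.2
    exact h⟩
  left_inv x := Subtype.ext (g.symm_apply_apply x)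
  right_inv x := Subtype.ext (g.apply_symm_apply x)
  contMDiff_toFun := contMDiff_boundary_of_val (g.contMDiff.comp contMDiff_boundary_val)
  contMDiff_invFun := contMDiff_boundary_of_val (g.symm.contMDiff.comp contMDiff_boundary_val)

@[simp] lemma boundaryDiffeomorph_coe (g : X ≃ₘ⟮I, I⟯ X) (x : I.boundary X) :
    (boundaryDiffeomorph g x : X) = g x := rfl

end Boundary

section Restriction

variable {E : Type*} [NormedAddCommGroup E] [NormedSpace ℝ E]
  {H : Type*} [TopologicalSpace H] {I : ModelWithCorners ℝ E H}
  {X : Type*} [TopologicalSpace X] [ChartedSpace H X] [IsManifold I ∞ X]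
  {F : Type*} [NormedAddCommGroup F] [NormedSpace ℝ F]
  {G : Type*} [TopologicalSpace G] {J : ModelWithCorners ℝ F G}
  {Y : Type*} [TopologicalSpace Y] [ChartedSpace G Y] [IsManifold J ∞ Y]

/-- The coordinate domain on which a map is read in two charts. -/
lemma exists_open_coordDomain {f : X → Y} (hf : ContMDiff I J ∞ f)
    {φ : OpenPartialHomeomorph X H} {ψ : OpenPartialHomeomorph Y G}
    (hφ : φ ∈ atlas H X) (hψ : ψ ∈ atlas G Y) :
    ∃ O : Set E, IsOpen O ∧ UniqueDiffOn ℝ (range I ∩ O) ∧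
      ContDiffOn ℝ ∞ (ψ.extend J ∘ f ∘ (φ.extend I).symm) (range I ∩ O) ∧
      (∀ v ∈ range I ∩ O, v ∈ (φ.extend I).target ∧ f ((φ.extend I).symm v) ∈ ψ.source) ∧
      ∀ x ∈ φ.source, f x ∈ ψ.source → φ.extend I x ∈ range I ∩ O := by
  have hW : IsOpen (φ.target ∩ φ.symm ⁻¹' (f ⁻¹' ψ.source)) :=
    φ.symm.isOpen_inter_preimage (ψ.open_source.preimage hf.continuous)
  refine ⟨I.symm ⁻¹' (φ.target ∩ φ.symm ⁻¹' (f ⁻¹' ψ.source)), hW.preimage I.continuous_symm,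
    ?_, ?_, ?_, ?_⟩
  · rw [inter_comm]
    exact I.uniqueDiffOn_preimage hW
  · rw [← contMDiffOn_iff_contDiffOn]
    have h1 : ContMDiffOn 𝓘(ℝ, E) I ∞ (φ.extend I).symm (I '' φ.target) :=
      contMDiffOn_extend_symm (IsManifold.subset_maximalAtlas hφ)
    have h2 : ContMDiffOn J 𝓘(ℝ, F) ∞ (ψ.extend J) ψ.source :=
      ψ.contMDiffOn_extend (IsManifold.subset_maximalAtlas hψ)
    refine h2.comp ((hf.contMDiffOn (s := univ)).comp (h1.mono ?_) fun _ _ => mem_univ _) ?_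
    · rintro v ⟨hv, hv1, -⟩
      exact ⟨I.symm v, hv1, I.right_inv hv⟩
    · rintro v ⟨-, -, hv2⟩
      exact hv2
  · rintro v ⟨hv, hv1, hv2⟩
    refine ⟨?_, hv2⟩
    rw [OpenPartialHomeomorph.extend_target]
    exact ⟨hv1, hv⟩
  · intro x hx hfx
    refine ⟨by simp, ?_⟩
    simp [hx, hfx]

lemma continuousOn_iteratedFDeriv_coord {f : X → Y} (hf : ContMDiff I J ∞ f)
    {φ : OpenPartialHomeomorph X H} {ψ : OpenPartialHomeomorph Y G}
    (hφ : φ ∈ atlas H X) (hψ : ψ ∈ atlas G Y) {K : Set X} (hK : K ⊆ φ.source)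
    (hfK : MapsTo f K ψ.source) (k : ℕ) :
    ContinuousOn (fun x => iteratedFDerivWithin ℝ k (ψ.extend J ∘ f ∘ (φ.extend I).symm)
      (range I) (φ.extend I x)) K := by
  obtain ⟨O, hO, hu, hc, -, hm⟩ := exists_open_coordDomain hf hφ hψ
  have h1 := hc.continuousOn_iteratedFDerivWithin (m := k) (by exact_mod_cast le_top) hu
  have h2 : ContinuousOn (φ.extend I) K := by
    have := φ.continuousOn_extend (I := I)
    rw [OpenPartialHomeomorph.extend_source] at this
    exact this.mono hK
  refine (h1.comp h2 fun x hx => hm x (hK hx) (hfK hx)).congr fun x hx => ?_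
  exact (iteratedFDerivWithin_inter_open hO (hm x (hK hx) (hfK hx)).2).symm

variable [HalfSpaceModel I] [FiniteDimensional ℝ E]

lemma iteratedFDeriv_boundary_coord (g : X ≃ₘ⟮I, I⟯ X) (a b z : I.boundary X)
    (hz : z.1 ∈ (chartAt H a.1).source) (hgz : g z ∈ (chartAt H b.1).source) (k : ℕ) :
    iteratedFDerivWithin ℝ k ((boundaryChart I b).extend 𝓘(ℝ, BoundaryModel I) ∘
        boundaryDiffeomorph g ∘ ((boundaryChart I a).extend 𝓘(ℝ, BoundaryModel I)).symm)
      (range 𝓘(ℝ, BoundaryModel I)) ((boundaryChart I a).extend 𝓘(ℝ, BoundaryModel I) z) =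
    (boundaryProj I).compContinuousMultilinearMap
      ((iteratedFDerivWithin ℝ k
        ((chartAt H b.1).extend I ∘ g ∘ ((chartAt H a.1).extend I).symm) (range I)
        ((chartAt H a.1).extend I z)).compContinuousLinearMap
          fun _ => (BoundaryModel I).subtypeL) := by
  obtain ⟨O, hO, hu, hc, ht, hm⟩ := exists_open_coordDomain g.contMDiff
    (chart_mem_atlas H a.1) (chart_mem_atlas H b.1)
  set C := (chartAt H b.1).extend I ∘ g ∘ ((chartAt H a.1).extend I).symm with hC
  have hzO := hm z.1 hz hgz
  set w : BoundaryModel I := boundaryChart I a z with hw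
  have hwz : (w : E) = (chartAt H a.1).extend I z :=
    boundaryProj_extChartAt a z (by simpa using hz)
  have hrange : ∀ v : BoundaryModel I, (v : E) ∈ range I := fun v => by
    rw [HalfSpaceModel.range_eq (I := I)]
    exact ge_of_eq v.2
  have hU : IsOpen ((BoundaryModel I).subtypeL ⁻¹' (range I ∩ O)) := by
    have : (BoundaryModel I).subtypeL ⁻¹' (range I ∩ O) = (BoundaryModel I).subtypeL ⁻¹' O := by
      ext v
      exact ⟨fun h => h.2, fun h => ⟨hrange v, h⟩⟩
    rw [this]
    exact hO.preimage (BoundaryModel I).subtypeL.continuous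
  have hwO : (BoundaryModel I).subtypeL w ∈ range I ∩ O := by
    show (w : E) ∈ _
    rw [hwz]; exact hzO
  have hcongr : EqOn ((boundaryChart I b).extend 𝓘(ℝ, BoundaryModel I) ∘
        boundaryDiffeomorph g ∘ ((boundaryChart I a).extend 𝓘(ℝ, BoundaryModel I)).symm)
      ((boundaryProj I ∘ C) ∘ (BoundaryModel I).subtypeL)
      ((BoundaryModel I).subtypeL ⁻¹' (range I ∩ O)) := by
    intro v hv
    have hv1 : (v : E) ∈ (extChartAt I a.1).target := (ht v hv).1
    show boundaryProj I (extChartAt I b.1 (g ((boundaryChart I a).symm v).1)) = _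
    rw [boundaryChart_symm_coe a hv1]
    rfl
  have hrw : range 𝓘(ℝ, BoundaryModel I) = univ := by simp
  rw [hrw]
  show iteratedFDerivWithin ℝ k _ univ w = _
  rw [← iteratedFDerivWithin_inter_open (s := univ) hU hwO, univ_inter,
    iteratedFDerivWithin_congr hcongr hwO,
    ContinuousLinearMap.iteratedFDerivWithin_comp_right (n := ∞) (BoundaryModel I).subtypeL
      ((boundaryProj I).contDiff.comp_contDiffOn hc) hu hU.uniqueDiffOn hwO
      (by exact_mod_cast le_top),
    ContinuousLinearMap.iteratedFDerivWithin_comp_left (n := ∞) (boundaryProj I)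
      (hc _ hwO) hu hwO (by exact_mod_cast le_top),
    iteratedFDerivWithin_inter_open hO hwO.2]
  show _ = _
  rw [← hwz]
  rfl

/-- Restriction to the boundary is continuous between the diffeomorphism groups. -/
lemma continuous_boundaryDiffeomorph :
    Continuous (boundaryDiffeomorph : (X ≃ₘ⟮I, I⟯ X) → _) := by
  rw [continuous_induced_rng, continuous_generateFrom_iff]
  rintro _ ⟨f, _, _, K, r, ε, ⟨a, rfl⟩, ⟨b, rfl⟩, hK, hKa, hfK, hε, rfl⟩
  rw [isOpen_iff_mem_nhds]
  rintro g₀ ⟨hg₀, hd₀⟩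
  have hKa' : Subtype.val '' K ⊆ (chartAt H a.1).source := by
    rintro _ ⟨x, hx, rfl⟩
    have : x.1 ∈ (extChartAt I a.1).source := hKa hx
    simpa using this
  have hg₀' : MapsTo g₀ (Subtype.val '' K) (chartAt H b.1).source := by
    rintro _ ⟨x, hx, rfl⟩
    have : g₀ x.1 ∈ (extChartAt I b.1).source := hg₀ hx
    simpa using this
  obtain ⟨η, hη, hηd⟩ : ∃ η > 0, ∀ k ∈ Finset.range (r + 1), ∀ x ∈ K,
      ‖iteratedFDerivWithin ℝ k ((boundaryChart I b).extend 𝓘(ℝ, BoundaryModel I) ∘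
        f ∘ ((boundaryChart I a).extend 𝓘(ℝ, BoundaryModel I)).symm)
      (range 𝓘(ℝ, BoundaryModel I)) ((boundaryChart I a).extend 𝓘(ℝ, BoundaryModel I) x) -
      iteratedFDerivWithin ℝ k ((boundaryChart I b).extend 𝓘(ℝ, BoundaryModel I) ∘
        boundaryDiffeomorph g₀ ∘ ((boundaryChart I a).extend 𝓘(ℝ, BoundaryModel I)).symm)
      (range 𝓘(ℝ, BoundaryModel I)) ((boundaryChart I a).extend 𝓘(ℝ, BoundaryModel I) x)‖ + η
        ≤ ε := by
    have key : ∀ᶠ η in 𝓝[>] (0 : ℝ), ∀ k ∈ Finset.range (r + 1), ∀ x ∈ K,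
      ‖iteratedFDerivWithin ℝ k ((boundaryChart I b).extend 𝓘(ℝ, BoundaryModel I) ∘
        f ∘ ((boundaryChart I a).extend 𝓘(ℝ, BoundaryModel I)).symm)
      (range 𝓘(ℝ, BoundaryModel I)) ((boundaryChart I a).extend 𝓘(ℝ, BoundaryModel I) x) -
      iteratedFDerivWithin ℝ k ((boundaryChart I b).extend 𝓘(ℝ, BoundaryModel I) ∘
        boundaryDiffeomorph g₀ ∘ ((boundaryChart I a).extend 𝓘(ℝ, BoundaryModel I)).symm)
      (range 𝓘(ℝ, BoundaryModel I)) ((boundaryChart I a).extend 𝓘(ℝ, BoundaryModel I) x)‖ + η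
        ≤ ε := by
      rw [Filter.eventually_all_finset]
      intro k hk
      rcases K.eq_empty_or_nonempty with rfl | hne
      · simp
      have hcont := ((continuousOn_iteratedFDeriv_coord f.contMDiff (mem_range_self a)
        (mem_range_self b) hKa hfK k).sub (continuousOn_iteratedFDeriv_coord
          (boundaryDiffeomorph g₀).contMDiff (mem_range_self a)
        (mem_range_self b) hKa hg₀ k)).norm
      obtain ⟨x₀, hx₀, hmax⟩ := hK.exists_isMaxOn hne hcont
      have hlt := hd₀ k (Nat.lt_succ_iff.1 (Finset.mem_range.1 hk)) x₀ hx₀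
      filter_upwards [Ioo_mem_nhdsGT (sub_pos.2 hlt)] with η hη x hx
      have h1 := hmax hx
      have h2 := hη.2
      simp only [mem_ofPred_eq] at h1
      have h3 := lt_sub_iff_add_lt'.1 h2
      exact (add_le_add_left h1 η).trans h3.le
    obtain ⟨η, h1, h2⟩ := (key.and self_mem_nhdsWithin).exists
    exact ⟨η, h2, h1⟩
  set δ : ℝ := η / (‖boundaryProj I‖ + 1) with hδ
  have hP : 0 < ‖boundaryProj I‖ + 1 := by positivity
  have hδ0 : 0 < δ := div_pos hη hP
  have hopen : IsOpen ((fun g : X ≃ₘ⟮I, I⟯ X => (g : C^∞⟮I, X; I, X⟯)) ⁻¹'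
      weakSmoothNhd (g₀ : C^∞⟮I, X; I, X⟯) (chartAt H a.1) (chartAt H b.1)
        (Subtype.val '' K) r δ) :=
    isOpen_induced (TopologicalSpace.isOpen_generateFrom_of_mem
      ⟨_, _, _, _, _, _, chart_mem_atlas H a.1, chart_mem_atlas H b.1,
        hK.image continuous_subtype_val, hKa', hg₀', hδ0, rfl⟩)
  refine Filter.mem_of_superset (hopen.mem_nhds ⟨hg₀', fun k _ x _ => by simpa using hδ0⟩) ?_
  rintro g ⟨hg, hd⟩
  refine ⟨fun x hx => ?_, fun k hk x hx => ?_⟩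
  · show g x.1 ∈ (extChartAt I b.1).source
    have := hg (mem_image_of_mem _ hx)
    rw [extChartAt_source]
    exact this
  have hb := hηd k (Finset.mem_range.2 (Nat.lt_succ_iff.2 hk)) x hx
  have hdx := hd k hk x.1 (mem_image_of_mem _ hx)
  have hx' := hKa' (mem_image_of_mem _ hx)
  have hAB := iteratedFDeriv_boundary_coord g₀ a b x hx' (hg₀' (mem_image_of_mem _ hx)) k
  have hAB' := iteratedFDeriv_boundary_coord g a b x hx' (hg (mem_image_of_mem _ hx)) k
  refine lt_of_le_of_lt (norm_sub_le_norm_sub_add_norm_sub _ _ _) (lt_of_lt_of_le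
    (add_lt_add_of_le_of_lt le_rfl ?_) hb)
  show ‖iteratedFDerivWithin ℝ k ((boundaryChart I b).extend 𝓘(ℝ, BoundaryModel I) ∘
        boundaryDiffeomorph g₀ ∘ ((boundaryChart I a).extend 𝓘(ℝ, BoundaryModel I)).symm)
      (range 𝓘(ℝ, BoundaryModel I)) ((boundaryChart I a).extend 𝓘(ℝ, BoundaryModel I) x) -
      iteratedFDerivWithin ℝ k ((boundaryChart I b).extend 𝓘(ℝ, BoundaryModel I) ∘
        boundaryDiffeomorph g ∘ ((boundaryChart I a).extend 𝓘(ℝ, BoundaryModel I)).symm)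
      (range 𝓘(ℝ, BoundaryModel I)) ((boundaryChart I a).extend 𝓘(ℝ, BoundaryModel I) x)‖ < η
  rw [hAB, hAB']
  set A := iteratedFDerivWithin ℝ k
    ((chartAt H b.1).extend I ∘ g₀ ∘ ((chartAt H a.1).extend I).symm) (range I)
    ((chartAt H a.1).extend I x)
  set A' := iteratedFDerivWithin ℝ k
    ((chartAt H b.1).extend I ∘ g ∘ ((chartAt H a.1).extend I).symm) (range I)
    ((chartAt H a.1).extend I x)
  have hdx' : ‖A - A'‖ < δ := hdx
  have hlin : (boundaryProj I).compContinuousMultilinearMap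
        (A.compContinuousLinearMap fun _ => (BoundaryModel I).subtypeL) -
      (boundaryProj I).compContinuousMultilinearMap
        (A'.compContinuousLinearMap fun _ => (BoundaryModel I).subtypeL) =
      (boundaryProj I).compContinuousMultilinearMap
        ((A - A').compContinuousLinearMap fun _ => (BoundaryModel I).subtypeL) := by
    ext v
    simp
  rw [hlin]
  have hι : ∏ _i : Fin k, ‖(BoundaryModel I).subtypeL‖ ≤ 1 :=
    Finset.prod_le_one (fun _ _ => by positivity) fun _ _ => Submodule.norm_subtypeL_le _
  calc _ ≤ ‖boundaryProj I‖ *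
        ‖(A - A').compContinuousLinearMap fun _ => (BoundaryModel I).subtypeL‖ :=
        ContinuousLinearMap.norm_compContinuousMultilinearMap_le _ _
    _ ≤ ‖boundaryProj I‖ * (‖A - A'‖ * ∏ _i : Fin k, ‖(BoundaryModel I).subtypeL‖) := by
        gcongr
        exact ContinuousMultilinearMap.norm_compContinuousLinearMap_le _ _
    _ ≤ ‖boundaryProj I‖ * (‖A - A'‖ * 1) := by gcongr
    _ ≤ ‖boundaryProj I‖ * δ := by rw [mul_one]; gcongr
    _ < (‖boundaryProj I‖ + 1) * δ := by nlinarith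
    _ = η := by rw [hδ]; field_simp

end Restriction

/-! ### Manifolds over a base -/

/-- A manifold over `B` with fibre `X`: a fibre bundle with fibre `X` and structure group the
diffeomorphism group of `X`, given by an atlas of local trivializations whose transition functions
are continuous maps to the diffeomorphism group. -/
structure ManifoldOver {E : Type*} [NormedAddCommGroup E] [NormedSpace ℝ E]
    {H : Type*} [TopologicalSpace H] (I : ModelWithCorners ℝ E H)
    (X : Type*) [TopologicalSpace X] [ChartedSpace H X]
    (B : Type*) [TopologicalSpace B] (T : Type*) [TopologicalSpace T] where
  /-- the bundle projection -/
  proj : T → B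
  /-- the atlas of local trivializations -/
  atlas : Set (Trivialization X proj)
  exists_mem_baseSet : ∀ b : B, ∃ e ∈ atlas, b ∈ e.baseSet
  transition : ∀ e ∈ atlas, ∀ e' ∈ atlas,
    ∃ g : (e.baseSet ∩ e'.baseSet : Set B) → (X ≃ₘ⟮I, I⟯ X), Continuous g ∧
      ∀ (b : (e.baseSet ∩ e'.baseSet : Set B)) (x : X),
        e' (e.toOpenPartialHomeomorph.symm (b, x)) = (↑b, g b x)

namespace ManifoldOver

section BoundaryOver

variable {E : Type*} [NormedAddCommGroup E] [NormedSpace ℝ E]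
  {H : Type*} [TopologicalSpace H] {I : ModelWithCorners ℝ E H}
  {X : Type*} [TopologicalSpace X] [ChartedSpace H X]
  {B : Type*} [TopologicalSpace B] {T : Type*} [TopologicalSpace T]
  (𝓧 : ManifoldOver I X B T)

/-- The total space of the boundary over `B`: the points that correspond to boundary points of the
fibre in a local trivialization of the atlas. -/
def boundaryTotal : Set T :=
  {z | ∃ e ∈ 𝓧.atlas, 𝓧.proj z ∈ e.baseSet ∧ (e z).2 ∈ I.boundary X}

variable {𝓧} in
lemma symm_mem_boundaryTotal {e : Trivialization X 𝓧.proj} (he : e ∈ 𝓧.atlas) {b : B}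
    (hb : b ∈ e.baseSet) {x : X} (hx : x ∈ I.boundary X) :
    e.toOpenPartialHomeomorph.symm (b, x) ∈ 𝓧.boundaryTotal := by
  refine ⟨e, he, ?_, ?_⟩
  · rw [e.proj_symm_apply' hb]; exact hb
  · rw [e.apply_symm_apply' hb]; exact hx

variable {𝓧} in
lemma mem_boundaryTotal_iff {e : Trivialization X 𝓧.proj} (he : e ∈ 𝓧.atlas) {z : T}
    (hz : 𝓧.proj z ∈ e.baseSet) : z ∈ 𝓧.boundaryTotal ↔ (e z).2 ∈ I.boundary X := by
  refine ⟨?_, fun h => ⟨e, he, hz, h⟩⟩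
  rintro ⟨e', he', hz', h⟩
  obtain ⟨g, -, hg⟩ := 𝓧.transition e' he' e he
  have h1 : e (e'.toOpenPartialHomeomorph.symm (𝓧.proj z, (e' z).2)) =
    (𝓧.proj z, g ⟨𝓧.proj z, ⟨hz', hz⟩⟩ (e' z).2) := hg ⟨𝓧.proj z, ⟨hz', hz⟩⟩ (e' z).2
  have h2 : ((𝓧.proj z, (e' z).2) : B × X) = e' z := by
    rw [← e'.coe_fst' hz']
  have h4 : e'.toOpenPartialHomeomorph.symm (e' z) = z :=
    e'.toOpenPartialHomeomorph.left_inv (e'.mem_source.2 hz')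
  rw [h2, h4] at h1
  rw [h1]
  have h3 : (e' z).2 ∈ (g ⟨𝓧.proj z, ⟨hz', hz⟩⟩) ⁻¹' I.boundary X := by
    rw [(g _).preimage_boundary (by simp)]; exact h
  exact h3

open Classical in
/-- The restriction of a local trivialization to the boundary over `B`. -/
def boundaryTrivialization (e : Trivialization X 𝓧.proj) (he : e ∈ 𝓧.atlas) :
    Trivialization (I.boundary X) (fun z : 𝓧.boundaryTotal => 𝓧.proj z) where
  toFun z := (𝓧.proj z, if h : (e z).2 ∈ I.boundary X then ⟨(e z).2, h⟩ else
    ⟨_, z.2.choose_spec.2.2⟩)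
  invFun p := if h : e.toOpenPartialHomeomorph.symm (p.1, p.2.1) ∈ 𝓧.boundaryTotal then ⟨_, h⟩ else
    ⟨_, symm_mem_boundaryTotal (𝓧.exists_mem_baseSet p.1).choose_spec.1
      (𝓧.exists_mem_baseSet p.1).choose_spec.2 p.2.2⟩
  source := (fun z : 𝓧.boundaryTotal => 𝓧.proj z) ⁻¹' e.baseSet
  target := e.baseSet ×ˢ univ
  map_source' z hz := ⟨hz, mem_univ _⟩
  map_target' p hp := by
    rw [dif_pos (symm_mem_boundaryTotal he hp.1 p.2.2)]
    show 𝓧.proj (e.toOpenPartialHomeomorph.symm (p.1, p.2.1)) ∈ e.baseSet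
    rw [e.proj_symm_apply' hp.1]; exact hp.1
  left_inv' z hz := by
    have h := (mem_boundaryTotal_iff he hz).1 z.2
    have h1 : e.toOpenPartialHomeomorph.symm (𝓧.proj z, (e z).2) = z := by
      have h2 : ((𝓧.proj z, (e z).2) : B × X) = e z := by rw [← e.coe_fst' hz]
      rw [h2]; exact e.toOpenPartialHomeomorph.left_inv (e.mem_source.2 hz)
    apply Subtype.ext
    simp only [dif_pos h, h1, Subtype.coe_prop, dif_pos]
  right_inv' p hp := by
    have h := symm_mem_boundaryTotal he hp.1 p.2.2
    have h1 : e (e.toOpenPartialHomeomorph.symm (p.1, p.2.1)) = (p.1, p.2.1) :=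
      e.apply_symm_apply' hp.1
    have h2 : 𝓧.proj (e.toOpenPartialHomeomorph.symm (p.1, p.2.1)) = p.1 := e.proj_symm_apply' hp.1
    simp only [dif_pos h, h1, h2, Subtype.coe_prop, dif_pos, Subtype.coe_eta]
  open_source := by
    have : (fun z : 𝓧.boundaryTotal => 𝓧.proj z) ⁻¹' e.baseSet = Subtype.val ⁻¹' e.source := by
      rw [e.source_eq]; rfl
    rw [this]
    exact e.open_source.preimage continuous_subtype_val
  open_target := e.open_baseSet.prod isOpen_univ
  continuousOn_toFun := by
    have h0 : MapsTo (Subtype.val : 𝓧.boundaryTotal → T)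
        ((fun z : 𝓧.boundaryTotal => 𝓧.proj z) ⁻¹' e.baseSet) e.source :=
      fun z hz => e.mem_source.2 hz
    have h1 : ContinuousOn (fun z : 𝓧.boundaryTotal => e z)
        ((fun z : 𝓧.boundaryTotal => 𝓧.proj z) ⁻¹' e.baseSet) :=
      e.continuousOn_toFun.comp continuous_subtype_val.continuousOn h0
    refine ContinuousOn.prodMk ?_ ?_
    · exact (continuous_fst.comp_continuousOn h1).congr fun z hz => (e.coe_fst' hz).symm
    · rw [IsInducing.subtypeVal.continuousOn_iff]
      refine (continuous_snd.comp_continuousOn h1).congr fun z hz => ?_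
      simp only [Function.comp_apply, dif_pos ((mem_boundaryTotal_iff he hz).1 z.2)]
  continuousOn_invFun := by
    rw [IsInducing.subtypeVal.continuousOn_iff]
    have h1 : ContinuousOn (fun p : B × I.boundary X =>
        e.toOpenPartialHomeomorph.symm (p.1, p.2.1)) (e.baseSet ×ˢ univ) := by
      refine e.toOpenPartialHomeomorph.continuousOn_symm.comp
        (f := fun p : B × I.boundary X => (p.1, p.2.1)) (by fun_prop) fun p hp => ?_
      rw [e.target_eq]
      exact ⟨hp.1, mem_univ _⟩
    refine h1.congr fun p hp => ?_
    simp only [Function.comp_apply, dif_pos (symm_mem_boundaryTotal he hp.1 p.2.2)]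
  baseSet := e.baseSet
  open_baseSet := e.open_baseSet
  source_eq := rfl
  target_eq := rfl
  proj_toFun _ _ := rfl

variable {𝓧} in
lemma boundaryTrivialization_apply_snd {e : Trivialization X 𝓧.proj} (he : e ∈ 𝓧.atlas)
    (z : 𝓧.boundaryTotal) (hz : 𝓧.proj z ∈ e.baseSet) :
    ((boundaryTrivialization 𝓧 e he z).2 : X) = (e z).2 := by
  have h : (boundaryTrivialization 𝓧 e he z).2 = ⟨(e z).2, (mem_boundaryTotal_iff he hz).1 z.2⟩ :=
    dif_pos ((mem_boundaryTotal_iff he hz).1 z.2)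
  rw [h]

variable {𝓧} in
lemma boundaryTrivialization_symm_coe {e : Trivialization X 𝓧.proj} (he : e ∈ 𝓧.atlas)
    {b : B} (hb : b ∈ e.baseSet) (x : I.boundary X) :
    ((boundaryTrivialization 𝓧 e he).toOpenPartialHomeomorph.symm (b, x) : T) =
      e.toOpenPartialHomeomorph.symm (b, x.1) := by
  have h : (boundaryTrivialization 𝓧 e he).toOpenPartialHomeomorph.symm (b, x) =
      ⟨e.toOpenPartialHomeomorph.symm (b, x.1), symm_mem_boundaryTotal he hb x.2⟩ :=
    dif_pos (symm_mem_boundaryTotal he hb x.2)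
  rw [h]

variable [IsManifold I ∞ X] [HalfSpaceModel I] [FiniteDimensional ℝ E]

/-- The boundary over `B`, a manifold over `B` whose fibre is the boundary of the fibre: its local
trivializations are the restrictions of those of the given manifold over `B`. -/
def boundary : ManifoldOver 𝓘(ℝ, BoundaryModel I) (I.boundary X) B 𝓧.boundaryTotal where
  proj z := 𝓧.proj z
  atlas := {e₀ | ∃ (e : Trivialization X 𝓧.proj) (he : e ∈ 𝓧.atlas),
    e₀ = boundaryTrivialization 𝓧 e he}
  exists_mem_baseSet b := by
    obtain ⟨e, he, hb⟩ := 𝓧.exists_mem_baseSet b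
    exact ⟨_, ⟨e, he, rfl⟩, hb⟩
  transition := by
    rintro _ ⟨e, he, rfl⟩ _ ⟨e', he', rfl⟩
    obtain ⟨g, hgc, hg⟩ := 𝓧.transition e he e' he'
    refine ⟨fun b => boundaryDiffeomorph (g b), continuous_boundaryDiffeomorph.comp hgc, ?_⟩
    rintro ⟨b, hb, hb'⟩ x
    have hproj : 𝓧.proj (e.toOpenPartialHomeomorph.symm (b, x.1)) = b := e.proj_symm_apply' hb
    refine Prod.ext ?_ (Subtype.ext ?_)
    · show 𝓧.proj ((boundaryTrivialization 𝓧 e he).toOpenPartialHomeomorph.symm (b, x) : T) = b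
      rw [boundaryTrivialization_symm_coe he hb, hproj]
    · rw [boundaryTrivialization_apply_snd he', boundaryTrivialization_symm_coe he hb]
      · exact congrArg Prod.snd (hg ⟨b, hb, hb'⟩ x.1)
      · rw [boundaryTrivialization_symm_coe he hb, hproj]
        exact hb'

end BoundaryOver

end ManifoldOver

/-! ### Embeddings -/

section Embeddings

variable {E : Type*} [NormedAddCommGroup E] [NormedSpace ℝ E]
  {H : Type*} [TopologicalSpace H] (I : ModelWithCorners ℝ E H)
  {X : Type*} [TopologicalSpace X] [ChartedSpace H X]
  {F : Type*} [NormedAddCommGroup F] [NormedSpace ℝ F]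
  {G : Type*} [TopologicalSpace G] (J : ModelWithCorners ℝ F G)
  {V : Type*} [TopologicalSpace V] [ChartedSpace G V]

/-- A smooth embedding of (finite-dimensional) manifolds, possibly with boundary: a smooth map with
injective differentials that is a homeomorphism onto its image. -/
structure SmoothEmb (f : X → V) : Prop where
  contMDiff : ContMDiff I J ∞ f
  injective_mfderiv : ∀ x, Injective (mfderiv I J f x)
  isEmbedding : IsEmbedding f

/-- A neat embedding: a smooth embedding `f : X → V` with `∂X = f⁻¹(∂V)` that is transverse to
`∂V`, i.e. `df (T_x X) + T_{f x} ∂V = T_{f x} V` at the boundary points `x`. -/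
structure NeatEmb [HalfSpaceModel J] (f : X → V) : Prop extends SmoothEmb I J f where
  preimage_boundary : f ⁻¹' J.boundary V = I.boundary X
  transverse : ∀ x ∈ I.boundary X,
    (show E →L[ℝ] F from mfderiv I J f x).range ⊔ BoundaryModel J = ⊤

variable {I}

namespace ManifoldOver

variable {B : Type*} [TopologicalSpace B] {T : Type*} [TopologicalSpace T]
  (𝓧 : ManifoldOver I X B T)

/-- A morphism of manifolds over `B` to the trivial family `B × V`: in each local trivialization it
is given by a family of smooth maps `X → V` that depends continuously on the point of `B` (in the
`C^∞` topology). -/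
def IsMorphism (h : T → B × V) : Prop :=
  ∀ e ∈ 𝓧.atlas, ∃ f : e.baseSet → C^∞⟮I, X; J, V⟯, Continuous f ∧
    ∀ (b : e.baseSet) (x : X), h (e.toOpenPartialHomeomorph.symm (b, x)) = (↑b, f b x)

/-- An embedding of manifolds over `B`: a morphism that is a homeomorphism onto its image and a
smooth embedding on each fibre. The fibre over `b` is identified with `X` by a local
trivialization. -/
structure IsEmbeddingOver (h : T → B × V) : Prop where
  isMorphism : 𝓧.IsMorphism J h
  isEmbedding : IsEmbedding h
  fibre : ∀ e ∈ 𝓧.atlas, ∀ b ∈ e.baseSet,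
    SmoothEmb I J (fun x => (h (e.toOpenPartialHomeomorph.symm (b, x))).2)

/-- A neat embedding of manifolds over `B`: an embedding over `B` that is a neat embedding on each
fibre. -/
structure IsNeatEmbeddingOver [HalfSpaceModel J] (h : T → B × V) : Prop
    extends 𝓧.IsEmbeddingOver J h where
  neat_fibre : ∀ e ∈ 𝓧.atlas, ∀ b ∈ e.baseSet,
    NeatEmb I J (fun x => (h (e.toOpenPartialHomeomorph.symm (b, x))).2)

end ManifoldOver

end Embeddings

/-- The inclusion of `ℝ^m` in the half-space of dimension `m + 1` as its boundary, `y ↦ (0, y)`. -/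
def halfSpaceBoundary (m : ℕ) (y : EuclideanSpace ℝ (Fin m)) : EuclideanHalfSpace (m + 1) :=
  ⟨WithLp.toLp 2 (Fin.cons 0 y), le_rfl⟩

end

/-! ### Smooth families of maps -/

lemma extend_mem_range {E H X : Type*} [NormedAddCommGroup E] [NormedSpace ℝ E]
    [TopologicalSpace H] {I : ModelWithCorners ℝ E H} [TopologicalSpace X]
    (φ : OpenPartialHomeomorph X H) (x : X) : φ.extend I x ∈ range I := by
  simp

section SmoothFamily

lemma eventually_mem_source_prod {S X H : Type*} [TopologicalSpace S] [TopologicalSpace X]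
    [TopologicalSpace H] {φ : OpenPartialHomeomorph X H} {x : X} (hx : x ∈ φ.source) (b : S) :
    ∀ᶠ p : S × X in 𝓝 (b, x), p.2 ∈ φ.source :=
  continuousAt_snd.eventually_mem (φ.open_source.mem_nhds hx)

variable {E : Type*} [NormedAddCommGroup E] [NormedSpace ℝ E]
  {H : Type*} [TopologicalSpace H] {I : ModelWithCorners ℝ E H}
  {X : Type*} [TopologicalSpace X] [ChartedSpace H X]
  {F : Type*} [NormedAddCommGroup F] [NormedSpace ℝ F]
  {G : Type*} [TopologicalSpace G] {J : ModelWithCorners ℝ F G}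
  {Y : Type*} [TopologicalSpace Y] [ChartedSpace G Y]
  {V : Type*} [NormedAddCommGroup V] [NormedSpace ℝ V]
  {W : Type*} [NormedAddCommGroup W] [NormedSpace ℝ W]
  {S : Type*} [TopologicalSpace S]

variable (I) in
/-- A family of smooth maps to a normed space, all of whose derivatives in charts depend
continuously on the parameter and the point together. -/
structure SmoothFamily (u : S → X → V) : Prop where
  contMDiff : ∀ b, ContMDiff I 𝓘(ℝ, V) ∞ (u b)
  continuousAt : ∀ φ ∈ atlas H X, ∀ (k : ℕ) (b : S), ∀ x ∈ φ.source,
    ContinuousAt (fun p : S × X => iteratedFDerivWithin ℝ k (u p.1 ∘ (φ.extend I).symm) (range I)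
      (φ.extend I p.2)) (b, x)

section Coord

variable [IsManifold I ∞ X]

lemma contDiffWithinAt_coord [IsManifold J ∞ Y] {f : X → Y} (hf : ContMDiff I J ∞ f)
    {φ : OpenPartialHomeomorph X H} {ψ : OpenPartialHomeomorph Y G}
    (hφ : φ ∈ atlas H X) (hψ : ψ ∈ atlas G Y) {x : X} (hx : x ∈ φ.source) (hfx : f x ∈ ψ.source) :
    ContDiffWithinAt ℝ ∞ (ψ.extend J ∘ f ∘ (φ.extend I).symm) (range I) (φ.extend I x) := by
  obtain ⟨O, hO, -, hc, -, hm⟩ := exists_open_coordDomain hf hφ hψ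
  have h := hm x hx hfx
  exact (contDiffWithinAt_inter (hO.mem_nhds h.2)).1 (hc _ h)

lemma contDiffWithinAt_coord_space {f : X → V} (hf : ContMDiff I 𝓘(ℝ, V) ∞ f)
    {φ : OpenPartialHomeomorph X H} (hφ : φ ∈ atlas H X) {x : X} (hx : x ∈ φ.source) :
    ContDiffWithinAt ℝ ∞ (f ∘ (φ.extend I).symm) (range I) (φ.extend I x) :=
  contDiffWithinAt_coord hf hφ (chart_mem_atlas V (0 : V)) hx (mem_univ _)

lemma continuousAt_iteratedFDeriv_coord_of_continuous [IsManifold J ∞ Y] [LocallyCompactSpace X]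
    {g : S → C^∞⟮I, X; J, Y⟯} (hg : Continuous g) {φ : OpenPartialHomeomorph X H}
    {ψ : OpenPartialHomeomorph Y G} (hφ : φ ∈ atlas H X) (hψ : ψ ∈ atlas G Y) {b : S} {x : X}
    (hx : x ∈ φ.source) (hgx : g b x ∈ ψ.source) :
    (∀ᶠ p : S × X in 𝓝 (b, x), p.2 ∈ φ.source ∧ g p.1 p.2 ∈ ψ.source) ∧
    ∀ k : ℕ, ContinuousAt (fun p : S × X => iteratedFDerivWithin ℝ k
      (ψ.extend J ∘ g p.1 ∘ (φ.extend I).symm) (range I) (φ.extend I p.2)) (b, x) := by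
  have hopen : IsOpen (φ.source ∩ g b ⁻¹' ψ.source) :=
    φ.open_source.inter (ψ.open_source.preimage (g b).contMDiff.continuous)
  obtain ⟨K, hK, hxK, hKs⟩ := exists_compact_subset hopen (show x ∈ _ from ⟨hx, hgx⟩)
  have hKφ : K ⊆ φ.source := fun y hy => (hKs hy).1
  have hKψ : MapsTo (g b) K ψ.source := fun y hy => (hKs hy).2
  have hKx : K ∈ 𝓝 x := mem_interior_iff_mem_nhds.1 hxK
  have key : ∀ (k : ℕ) (ε : ℝ), 0 < ε → ∀ᶠ c in 𝓝 b, g c ∈ weakSmoothNhd (g b) φ ψ K k ε := by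
    intro k ε hε
    refine hg.continuousAt.eventually_mem (IsOpen.mem_nhds ?_ ⟨hKψ, fun _ _ _ _ => by simpa⟩)
    exact TopologicalSpace.isOpen_generateFrom_of_mem
      ⟨g b, φ, ψ, K, k, ε, hφ, hψ, hK, hKφ, hKψ, hε, rfl⟩
  have hK2 : ∀ᶠ p : S × X in 𝓝 (b, x), p.2 ∈ K := continuousAt_snd.eventually_mem hKx
  refine ⟨?_, fun k => ?_⟩
  · filter_upwards [continuousAt_fst.eventually (key 0 1 one_pos), hK2] with p hp hp2
    exact ⟨hKφ hp2, hp.1 hp2⟩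
  · rw [Metric.continuousAt_iff']
    intro ε hε
    have h1 : ContinuousAt (fun y => iteratedFDerivWithin ℝ k
        (ψ.extend J ∘ g b ∘ (φ.extend I).symm) (range I) (φ.extend I y)) x :=
      (continuousOn_iteratedFDeriv_coord (g b).contMDiff hφ hψ hKφ hKψ k).continuousAt hKx
    have h2 := (Metric.continuousAt_iff'.1 h1) (ε / 2) (half_pos hε)
    filter_upwards [continuousAt_fst.eventually (key k (ε / 2) (half_pos hε)), hK2,
      continuousAt_snd.eventually h2] with p hp hp2 hp3
    have h3 := hp.2 k le_rfl p.2 hp2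
    rw [← dist_eq_norm, dist_comm] at h3
    exact (dist_triangle _ _ _).trans_lt ((add_lt_add h3 hp3).trans_eq (add_halves ε))

end Coord

lemma continuousAt_taylorComp {P : Type*} [TopologicalSpace P]
    {q : P → FormalMultilinearSeries ℝ E V} {r : P → FormalMultilinearSeries ℝ F E} {a : P}
    (hq : ∀ k, ContinuousAt (fun p => q p k) a) (hr : ∀ k, ContinuousAt (fun p => r p k) a)
    (k : ℕ) : ContinuousAt (fun p => (q p).taylorComp (r p) k) a := by
  unfold FormalMultilinearSeries.taylorComp
  refine tendsto_finsetSum _ fun c _ => ?_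
  have h1 : ContinuousAt (fun p => c.compAlongOrderedFinpartitionL ℝ F E V (q p c.length)) a :=
    (c.compAlongOrderedFinpartitionL ℝ F E V).continuous.continuousAt.comp (hq _)
  have h2 : ContinuousAt (fun p => fun m : Fin c.length => r p (c.partSize m)) a :=
    continuousAt_pi.2 fun m => hr _
  exact (ContinuousEval.continuous_eval.continuousAt).comp (h1.prodMk h2)

namespace SmoothFamily

lemma of_local {u : S → X → V}
    (h : ∀ b : S, ∃ U : Set S, IsOpen U ∧ b ∈ U ∧ SmoothFamily I (fun c : U => u c)) :
    SmoothFamily I u where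
  contMDiff b := by
    obtain ⟨U, -, hb, hU⟩ := h b
    exact hU.contMDiff ⟨b, hb⟩
  continuousAt φ hφ k b x hx := by
    obtain ⟨U, hUo, hb, hU⟩ := h b
    have he : IsOpenEmbedding (Prod.map (Subtype.val : U → S) (id : X → X)) :=
      hUo.isOpenEmbedding_subtypeVal.prodMap IsOpenEmbedding.id
    exact (he.continuousAt_iff (x := (⟨b, hb⟩, x))).1 (hU.continuousAt φ hφ k ⟨b, hb⟩ x hx)

lemma zero : SmoothFamily I (fun (_ : S) (_ : X) => (0 : V)) where
  contMDiff _ := contMDiff_const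
  continuousAt φ hφ k b x hx := by
    have : ∀ p : S × X, iteratedFDerivWithin ℝ k ((fun _ : X => (0 : V)) ∘ (φ.extend I).symm)
        (range I) (φ.extend I p.2) = 0 := fun p => by
      show iteratedFDerivWithin ℝ k (fun _ => (0 : V)) (range I) _ = 0
      simp
    simp only [this]
    exact continuousAt_const

variable [IsManifold I ∞ X]

lemma add {u v : S → X → V} (hu : SmoothFamily I u) (hv : SmoothFamily I v) :
    SmoothFamily I (fun b x => u b x + v b x) where
  contMDiff b := (hu.contMDiff b).add (hv.contMDiff b)
  continuousAt φ hφ k b x hx := by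
    refine ((hu.continuousAt φ hφ k b x hx).add (hv.continuousAt φ hφ k b x hx)).congr ?_
    filter_upwards [eventually_mem_source_prod hx b] with p hp
    exact (iteratedFDerivWithin_add_apply
      ((contDiffWithinAt_coord_space (hu.contMDiff p.1) hφ hp).of_le (by exact_mod_cast le_top))
      ((contDiffWithinAt_coord_space (hv.contMDiff p.1) hφ hp).of_le (by exact_mod_cast le_top))
      I.uniqueDiffOn (extend_mem_range φ p.2)).symm

lemma sum {ι : Type*} (s : Finset ι) {u : ι → S → X → V} (hu : ∀ i ∈ s, SmoothFamily I (u i)) :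
    SmoothFamily I (fun b x => ∑ i ∈ s, u i b x) := by
  classical
  induction s using Finset.induction_on with
  | empty => simpa using zero
  | insert i s hi ih =>
    simp only [Finset.sum_insert hi]
    exact (hu i (by simp)).add (ih fun j hj => hu j (by simp [hj]))

lemma clm {u : S → X → V} (hu : SmoothFamily I u) (L : V →L[ℝ] W) :
    SmoothFamily I (fun b x => L (u b x)) where
  contMDiff b := L.contMDiff.comp (hu.contMDiff b)
  continuousAt φ hφ k b x hx := by
    refine ((ContinuousLinearMap.compContinuousMultilinearMapL ℝ (fun _ : Fin k => E) V W
      L).continuous.continuousAt.comp (hu.continuousAt φ hφ k b x hx)).congr ?_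
    filter_upwards [eventually_mem_source_prod hx b] with p hp
    exact (ContinuousLinearMap.iteratedFDerivWithin_comp_left (n := ∞) L
      (contDiffWithinAt_coord_space (hu.contMDiff p.1) hφ hp)
      I.uniqueDiffOn (extend_mem_range φ p.2) (by exact_mod_cast le_top)).symm

lemma smul {u : S → X → V} (hu : SmoothFamily I u) {c : S → ℝ} (hc : Continuous c) :
    SmoothFamily I (fun b x => c b • u b x) where
  contMDiff b := (c b • ContinuousLinearMap.id ℝ V).contMDiff.comp (hu.contMDiff b)
  continuousAt φ hφ k b x hx := by
    refine ((hc.comp continuous_fst).continuousAt.smul (hu.continuousAt φ hφ k b x hx)).congr ?_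
    filter_upwards [eventually_mem_source_prod hx b] with p hp
    exact (iteratedFDerivWithin_const_smul_apply
      ((contDiffWithinAt_coord_space (hu.contMDiff p.1) hφ hp).of_le (by exact_mod_cast le_top))
      I.uniqueDiffOn (extend_mem_range φ p.2)).symm

lemma comp_diffeomorph [LocallyCompactSpace X] {g : S → X ≃ₘ⟮I, I⟯ X} (hg : Continuous g)
    {f : X → V} (hf : ContMDiff I 𝓘(ℝ, V) ∞ f) : SmoothFamily I (fun b x => f (g b x)) where
  contMDiff b := hf.comp (g b).contMDiff
  continuousAt φ hφ k b x hx := by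
    set ψ := chartAt H (g b x)
    have hψ : ψ ∈ atlas H X := chart_mem_atlas H _
    have hgx : g b x ∈ ψ.source := mem_chart_source H _
    obtain ⟨hev, hcont⟩ := continuousAt_iteratedFDeriv_coord_of_continuous
      (g := fun b => (g b : C^∞⟮I, X; I, X⟯)) (continuous_induced_dom.comp hg) hφ hψ hx hgx
    have hval : ContinuousAt (fun p : S × X => g p.1 p.2) (b, x) := by
      have h1 : ContinuousAt (fun p : S × X => ψ.extend I (g p.1 p.2)) (b, x) := by
        have h0 := (continuousMultilinearCurryFin0 ℝ E E).continuous.continuousAt.comp (hcont 0)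
        refine h0.congr ?_
        filter_upwards [hev] with p hp
        have : (φ.extend I).symm (φ.extend I p.2) = p.2 := φ.extend_left_inv hp.1
        show ψ.extend I (g p.1 ((φ.extend I).symm (φ.extend I p.2))) = _
        rw [this]
      have h2 : ContinuousAt (ψ.extend I).symm (ψ.extend I (g b x)) :=
        ψ.continuousAt_extend_symm hgx
      refine (ContinuousAt.comp (f := fun p : S × X => ψ.extend I (g p.1 p.2)) (x := (b, x))
        (g := (ψ.extend I).symm) h2 h1).congr ?_
      filter_upwards [hev] with p hp
      exact ψ.extend_left_inv hp.2
    have hq : ∀ j : ℕ, ContinuousAt (fun p : S × X => iteratedFDerivWithin ℝ j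
        (f ∘ (ψ.extend I).symm) (range I) (ψ.extend I (g p.1 p.2))) (b, x) := by
      intro j
      have h1 := (continuousOn_iteratedFDeriv_coord hf hψ (chart_mem_atlas V (0 : V)) subset_rfl
        (fun _ _ => mem_univ _) j).continuousAt (ψ.open_source.mem_nhds hgx)
      exact ContinuousAt.comp (f := fun p : S × X => g p.1 p.2) h1 hval
    refine (continuousAt_taylorComp (q := fun p : S × X => ftaylorSeriesWithin ℝ
        (f ∘ (ψ.extend I).symm) (range I) (ψ.extend I (g p.1 p.2)))
      (r := fun p : S × X => ftaylorSeriesWithin ℝ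
        (ψ.extend I ∘ g p.1 ∘ (φ.extend I).symm) (range I) (φ.extend I p.2)) hq hcont k).congr ?_
    filter_upwards [hev] with p hp
    have hp1 : (φ.extend I).symm (φ.extend I p.2) = p.2 := φ.extend_left_inv hp.1
    have hp2 : (ψ.extend I ∘ g p.1 ∘ (φ.extend I).symm) (φ.extend I p.2) =
        ψ.extend I (g p.1 p.2) := by
      simp only [Function.comp_apply, hp1]
    have h1 : ContDiffWithinAt ℝ ∞ (f ∘ (ψ.extend I).symm) (range I)
        ((ψ.extend I ∘ g p.1 ∘ (φ.extend I).symm) (φ.extend I p.2)) := by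
      rw [hp2]; exact contDiffWithinAt_coord_space hf hψ hp.2
    have h2 := contDiffWithinAt_coord (g p.1).contMDiff hφ hψ hp.1 hp.2
    have h3 := iteratedFDerivWithin_comp h1 h2 I.uniqueDiffOn I.uniqueDiffOn
      (extend_mem_range φ p.2) (fun v _ => extend_mem_range ψ _) (i := k)
      (by exact_mod_cast le_top)
    simp only [hp2] at h3
    rw [← h3]
    obtain ⟨O, hO, -, -, ht, hm⟩ := exists_open_coordDomain (g p.1).contMDiff hφ hψ
    have hmem := hm _ hp.1 hp.2
    rw [← iteratedFDerivWithin_inter_open hO hmem.2,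
      ← iteratedFDerivWithin_inter_open (f := (fun x => f (g p.1 x)) ∘ _) hO hmem.2]
    refine iteratedFDerivWithin_congr (fun v hv => ?_) hmem k
    show f ((ψ.extend I).symm (ψ.extend I (g p.1 ((φ.extend I).symm v)))) = _
    rw [ψ.extend_left_inv (ht v hv).2]
    rfl

/-- A family that is cut off by a function supported where the family is defined. -/
lemma smul_of_tsupport_subset {c : S → ℝ} (hc : Continuous c) {U : Set S} (hU : IsOpen U)
    (hcU : tsupport c ⊆ U) {u : S → X → V} (hu : SmoothFamily I (fun b : U => u b)) :
    SmoothFamily I (fun b x => c b • u b x) := by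
  refine of_local fun b => ?_
  by_cases hb : b ∈ U
  · exact ⟨U, hU, hb, hu.smul (hc.comp continuous_subtype_val)⟩
  · refine ⟨(tsupport c)ᶜ, (isClosed_tsupport c).isOpen_compl, fun h => hb (hcU h), ?_⟩
    have : ∀ b : ((tsupport c)ᶜ : Set S), c b = 0 := fun b => image_eq_zero_of_notMem_tsupport b.2
    simpa only [this, zero_smul] using zero

end SmoothFamily

end SmoothFamily

/-! ### Maps to a model space with corners -/

section ModelSpace

variable {E : Type*} [NormedAddCommGroup E] [NormedSpace ℝ E]
  {H : Type*} [TopologicalSpace H] {I : ModelWithCorners ℝ E H}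
  {X : Type*} [TopologicalSpace X] [ChartedSpace H X]
  {V : Type*} [NormedAddCommGroup V] [NormedSpace ℝ V]
  {G : Type*} [TopologicalSpace G] {J : ModelWithCorners ℝ V G}
  {W : Type*} [NormedAddCommGroup W] [NormedSpace ℝ W]
  {S : Type*} [TopologicalSpace S]

lemma contMDiff_modelSpace_iff {n : WithTop ℕ∞} {f : X → G} :
    ContMDiff I J n f ↔ ContMDiff I 𝓘(ℝ, V) n (fun x => J (f x)) := by
  refine forall_congr' fun x => ?_
  rw [contMDiffAt_iff_target]
  have h : extChartAt J (f x) ∘ f = fun x => J (f x) := by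
    ext y; simp [chartAt_self_eq]
  rw [h]
  refine ⟨fun h => h.2, fun h => ⟨?_, h⟩⟩
  exact J.isClosedEmbedding.isInducing.continuousAt_iff.2 h.continuousAt

lemma mfderiv_modelSpace {f : X → G} {x : X} (hf : MDifferentiableAt I J f x) :
    mfderiv I J f x = mfderiv I 𝓘(ℝ, V) (fun x => J (f x)) x := by
  have h2 : MDifferentiableAt I 𝓘(ℝ, V) (fun x => J (f x)) x := by
    refine ⟨(J.continuous.continuousAt.comp hf.continuousAt).continuousWithinAt, ?_⟩
    simpa [DifferentiableWithinAtProp, Function.comp_def, chartAt_self_eq] using hf.2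
  rw [hf.mfderiv, h2.mfderiv]
  congr 1

lemma continuous_of_smoothFamily [IsManifold I ∞ X] {f : S → C^∞⟮I, X; J, G⟯}
    (hf : SmoothFamily I (fun b x => J (f b x))) : Continuous f := by
  rw [continuous_generateFrom_iff]
  rintro _ ⟨g, φ, ψ, K, r, ε, hφ, hψ, hK, hKφ, hgK, hε, rfl⟩
  rw [chartedSpaceSelf_atlas] at hψ
  subst hψ
  rw [isOpen_iff_mem_nhds]
  rintro b ⟨-, hb⟩
  have key : ∀ k ∈ Finset.range (r + 1), ∀ᶠ c in 𝓝 b, ∀ x ∈ K,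
      ‖iteratedFDerivWithin ℝ k ((fun x => J (g x)) ∘ (φ.extend I).symm) (range I) (φ.extend I x) -
      iteratedFDerivWithin ℝ k ((fun x => J (f c x)) ∘ (φ.extend I).symm) (range I)
        (φ.extend I x)‖ < ε := by
    intro k hk
    refine hK.eventually_forall_of_forall_eventually fun x hx => ?_
    have h1 := (continuousOn_iteratedFDeriv_coord (contMDiff_modelSpace_iff.1 g.contMDiff) hφ
      (chart_mem_atlas V (0 : V)) subset_rfl (fun _ _ => mem_univ _) k).continuousAt
        (φ.open_source.mem_nhds (hKφ hx))
    have h2 : ContinuousAt (fun p : S × X => iteratedFDerivWithin ℝ k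
        ((fun x => J (g x)) ∘ (φ.extend I).symm) (range I) (φ.extend I p.2)) (b, x) :=
      ContinuousAt.comp (f := (Prod.snd : S × X → X)) (x := (b, x)) h1 continuousAt_snd
    exact (h2.sub (hf.continuousAt φ hφ k b x (hKφ hx))).norm.eventually_lt_const
      (hb k (Nat.lt_succ_iff.1 (Finset.mem_range.1 hk)) x hx)
  filter_upwards [(Filter.eventually_all_finset _).2 key] with c hc
  exact ⟨fun _ _ => mem_univ _, fun k hk x hx =>
    hc k (Finset.mem_range.2 (Nat.lt_succ_iff.2 hk)) x hx⟩

lemma SmoothEmb.of_clm_comp {f : X → G} (hf : ContMDiff I J ∞ f) (L : V →L[ℝ] W)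
    (h : SmoothEmb I 𝓘(ℝ, W) (fun x => L (J (f x)))) : SmoothEmb I J f where
  contMDiff := hf
  injective_mfderiv x := by
    have h1 := (contMDiff_modelSpace_iff.1 hf).mdifferentiableAt (x := x) (by simp)
    have h2 := (L.hasMFDerivAt (x := J (f x))).comp x h1.hasMFDerivAt
    have h3 := h.injective_mfderiv x
    rw [show (fun x => L (J (f x))) = L ∘ (fun x => J (f x)) from rfl, h2.mfderiv] at h3
    rw [mfderiv_modelSpace (hf.mdifferentiableAt (by simp))]
    exact Injective.of_comp (f := L) h3
  isEmbedding := IsEmbedding.of_comp hf.continuous (L.continuous.comp J.continuous) h.isEmbedding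

lemma mfderiv_diffeomorph_bijective (g : X ≃ₘ⟮I, I⟯ X) (x : X) :
    Bijective (mfderiv I I g x) :=
  (g.mfderivToContinuousLinearEquiv (by simp) x).bijective

lemma SmoothEmb.comp_diffeomorph {f : X → W} (h : SmoothEmb I 𝓘(ℝ, W) f) (g : X ≃ₘ⟮I, I⟯ X) :
    SmoothEmb I 𝓘(ℝ, W) (fun x => f (g x)) where
  contMDiff := h.contMDiff.comp g.contMDiff
  injective_mfderiv x := by
    rw [show (fun x => f (g x)) = f ∘ g from rfl,
      mfderiv_comp x (h.contMDiff.mdifferentiableAt (by simp))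
        (g.contMDiff.mdifferentiableAt (by simp))]
    exact (h.injective_mfderiv (g x)).comp (mfderiv_diffeomorph_bijective g x).1
  isEmbedding := h.isEmbedding.comp g.toHomeomorph.isEmbedding

lemma SmoothEmb.clm_comp {f : X → V} (h : SmoothEmb I 𝓘(ℝ, V) f) (L : V ≃L[ℝ] W) :
    SmoothEmb I 𝓘(ℝ, W) (fun x => L (f x)) where
  contMDiff := (L : V →L[ℝ] W).contMDiff.comp h.contMDiff
  injective_mfderiv x := by
    have h2 := ((L : V →L[ℝ] W).hasMFDerivAt (x := f x)).comp x
      (h.contMDiff.mdifferentiableAt (x := x) (by simp)).hasMFDerivAt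
    rw [show (fun x => L (f x)) = (L : V →L[ℝ] W) ∘ f from rfl, h2.mfderiv]
    exact L.injective.comp (h.injective_mfderiv x)
  isEmbedding := L.toHomeomorph.isEmbedding.comp h.isEmbedding

lemma SmoothEmb.const_smul {f : X → W} (h : SmoothEmb I 𝓘(ℝ, W) f) {c : ℝ} (hc : c ≠ 0) :
    SmoothEmb I 𝓘(ℝ, W) (fun x => c • f x) :=
  h.clm_comp (ContinuousLinearEquiv.smulLeft (R₁ := ℝ) (Units.mk0 c hc))

end ModelSpace

/-! ### Embeddings over a base from a partition of unity -/

namespace ManifoldOver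

section Glue

variable {E : Type*} [NormedAddCommGroup E] [NormedSpace ℝ E]
  {H : Type*} [TopologicalSpace H] {I : ModelWithCorners ℝ E H}
  {X : Type*} [TopologicalSpace X] [ChartedSpace H X]
  {B : Type*} [TopologicalSpace B] {T : Type*} [TopologicalSpace T]
  {𝓧 : ManifoldOver I X B T}
  {V : Type*} [NormedAddCommGroup V] [NormedSpace ℝ V]
  {G : Type*} [TopologicalSpace G] {J : ModelWithCorners ℝ V G}
  {W : Type*} [NormedAddCommGroup W] [NormedSpace ℝ W]
  {W' : Type*} [NormedAddCommGroup W'] [NormedSpace ℝ W']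
  {ι : Type*} [Fintype ι]

lemma exists_diffeomorph {e e' : Trivialization X 𝓧.proj} (he : e ∈ 𝓧.atlas) (he' : e' ∈ 𝓧.atlas)
    {b : B} (hb : b ∈ e.baseSet) (hb' : b ∈ e'.baseSet) :
    ∃ g : X ≃ₘ⟮I, I⟯ X, ∀ x, (e' (e.toOpenPartialHomeomorph.symm (b, x))).2 = g x := by
  obtain ⟨g, -, hg⟩ := 𝓧.transition e he e' he'
  exact ⟨g ⟨b, hb, hb'⟩, fun x => congrArg Prod.snd (hg ⟨b, hb, hb'⟩ x)⟩

variable [IsManifold I ∞ X] [LocallyCompactSpace X]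

lemma smoothFamily_cutoff {e e' : Trivialization X 𝓧.proj} (he : e ∈ 𝓧.atlas)
    (he' : e' ∈ 𝓧.atlas) {c : B → ℝ} (hc : Continuous c) (hcs : tsupport c ⊆ e'.baseSet)
    {f : X → W} (hf : ContMDiff I 𝓘(ℝ, W) ∞ f) :
    SmoothFamily I (fun (b : e.baseSet) (x : X) =>
      c b • f (e' (e.toOpenPartialHomeomorph.symm (b, x))).2) := by
  obtain ⟨g, hgc, hg⟩ := 𝓧.transition e he e' he'
  refine SmoothFamily.smul_of_tsupport_subset (c := fun b : e.baseSet => c b)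
    (hc.comp continuous_subtype_val)
    (U := Subtype.val ⁻¹' e'.baseSet) (e'.open_baseSet.preimage continuous_subtype_val) ?_ ?_
  · exact (tsupport_comp_subset_preimage c continuous_subtype_val).trans (preimage_mono hcs)
  · have h1 : Continuous (fun b : (Subtype.val ⁻¹' e'.baseSet : Set e.baseSet) =>
        (⟨b.1.1, b.1.2, b.2⟩ : (e.baseSet ∩ e'.baseSet : Set B))) := by fun_prop
    have h2 := SmoothFamily.comp_diffeomorph (hgc.comp h1) hf
    convert h2 using 3 with b x
    exact congrArg f (congrArg Prod.snd (hg ⟨b.1.1, b.1.2, b.2⟩ x))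

variable {e : ι → Trivialization X 𝓧.proj} {c : ι → B → ℝ} {f : X → W} {A : ι → W →L[ℝ] V}
  {P : ι → V →L[ℝ] W'} {Q : W →L[ℝ] W'} {h : T → B × G}

/-- Embeddings of the fibre, read in finitely many local trivializations and cut off by functions
on the base, combine to an embedding over the base. -/
theorem isEmbeddingOver_of_cutoff (he : ∀ i, e i ∈ 𝓧.atlas) (hc : ∀ i, Continuous (c i))
    (hcs : ∀ i, tsupport (c i) ⊆ (e i).baseSet) (hc0 : ∀ b, ∃ i, c i b ≠ 0)
    (hf : ContMDiff I 𝓘(ℝ, W) ∞ f) (hPA : ∀ i w, P i (A i w) = Q w)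
    (hPA' : ∀ i j w, i ≠ j → P i (A j w) = 0) (hQ : SmoothEmb I 𝓘(ℝ, W') (fun x => Q (f x)))
    (hfst : ∀ z, (h z).1 = 𝓧.proj z)
    (hsnd : ∀ z, J (h z).2 = ∑ i, c i (𝓧.proj z) • A i (f (e i z).2)) :
    𝓧.IsEmbeddingOver J h := by
  have hproj : ∀ i z, P i (J (h z).2) = c i (𝓧.proj z) • Q (f (e i z).2) := by
    intro i z
    rw [hsnd, map_sum, Finset.sum_eq_single i]
    · rw [map_smul, hPA]
    · intro j _ hji
      rw [map_smul, hPA' i j _ hji.symm, smul_zero]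
    · simp
  have hmem : ∀ i b, c i b ≠ 0 → b ∈ (e i).baseSet := fun i b hb => hcs i (subset_tsupport _ hb)
  have hfam : ∀ e' ∈ 𝓧.atlas, SmoothFamily I (fun (b : e'.baseSet) (x : X) =>
      J (h (e'.toOpenPartialHomeomorph.symm (b, x))).2) := by
    intro e' he'
    have h1 := SmoothFamily.sum Finset.univ fun i _ =>
      (smoothFamily_cutoff he' (he i) (hc i) (hcs i) hf).clm (A i)
    convert h1 using 3 with b x
    rw [hsnd, e'.proj_symm_apply' b.2]
    simp only [map_smul]
  have hsmooth : ∀ e' ∈ 𝓧.atlas, ∀ b ∈ e'.baseSet, ContMDiff I J ∞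
      (fun x => (h (e'.toOpenPartialHomeomorph.symm (b, x))).2) := fun e' he' b hb =>
    contMDiff_modelSpace_iff.2 ((hfam e' he').contMDiff ⟨b, hb⟩)
  have hcont : Continuous h := by
    have hpc : Continuous 𝓧.proj := by
      rw [continuous_iff_continuousAt]
      intro z
      obtain ⟨e', -, hz⟩ := 𝓧.exists_mem_baseSet (𝓧.proj z)
      exact e'.continuousAt_proj (e'.mem_source.2 hz)
    have h2 : Continuous (fun z => J (h z).2) := by
      simp only [hsnd]
      refine continuous_finsetSum _ fun i _ => ?_
      rw [continuous_iff_continuousAt]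
      intro z
      by_cases hz : 𝓧.proj z ∈ tsupport (c i)
      · refine ((hc i).comp hpc).continuousAt.smul ((A i).continuous.continuousAt.comp
          (hf.continuous.continuousAt.comp (continuousAt_snd.comp ?_)))
        exact (e i).continuousAt ((e i).mem_source.2 (hcs i hz))
      · refine (continuousAt_const (y := (0 : V))).congr ?_
        filter_upwards [hpc.continuousAt.eventually_mem
          ((isClosed_tsupport (c i)).isOpen_compl.mem_nhds hz)] with y hy
        rw [image_eq_zero_of_notMem_tsupport hy, zero_smul]
    have h3 : Continuous (fun z => (h z).2) :=
      J.isClosedEmbedding.isInducing.continuous_iff.2 h2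
    exact (hpc.prodMk h3).congr fun z => Prod.ext (hfst z).symm rfl
  refine ⟨fun e' he' => ?_, ⟨?_, ?_⟩, fun e' he' b hb => ?_⟩
  · refine ⟨fun b => ⟨_, hsmooth e' he' b b.2⟩, continuous_of_smoothFamily (hfam e' he'), ?_⟩
    exact fun b x => Prod.ext ((hfst _).trans (e'.proj_symm_apply' b.2)) rfl
  · rw [isInducing_iff_nhds]
    intro z
    refine le_antisymm hcont.continuousAt.le_comap ?_
    obtain ⟨i, hi⟩ := hc0 (𝓧.proj z)
    have hl : Filter.Tendsto h (Filter.comap h (𝓝 (h z))) (𝓝 (h z)) := Filter.tendsto_comap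
    have hl1 : Filter.Tendsto 𝓧.proj (Filter.comap h (𝓝 (h z))) (𝓝 (𝓧.proj z)) := by
      have := (continuous_fst.tendsto (h z)).comp hl
      rw [hfst] at this
      exact this.congr hfst
    have hl2 := ((P i).continuous.comp (J.continuous.comp continuous_snd)).continuousAt.tendsto.comp
      hl
    have hci := ((hc i).tendsto _).comp hl1
    have hne := hci.eventually_ne hi
    have hl3 : Filter.Tendsto (fun y => Q (f (e i y).2)) (Filter.comap h (𝓝 (h z)))
        (𝓝 (Q (f (e i z).2))) := by
      have h1 := (hci.inv₀ hi).smul hl2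
      simp only [Function.comp_apply, hproj, inv_smul_smul₀ hi] at h1
      refine h1.congr' ?_
      filter_upwards [hne] with y hy
      exact inv_smul_smul₀ hy _
    have hl4 := hQ.isEmbedding.isInducing.tendsto_nhds_iff.2 hl3
    have hl5 : Filter.Tendsto (fun y => e i y) (Filter.comap h (𝓝 (h z))) (𝓝 (e i z)) := by
      rw [← Prod.mk.eta (p := e i z), (e i).coe_fst' (hmem i _ hi)]
      refine (hl1.prodMk_nhds hl4).congr' ?_
      filter_upwards [hne] with y hy
      exact Prod.ext ((e i).coe_fst' (hmem i _ hy)).symm rfl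
    have hsrc : ∀ y, c i (𝓧.proj y) ≠ 0 → y ∈ (e i).source := fun y hy =>
      (e i).mem_source.2 (hmem i _ hy)
    have hl6 := ((e i).toOpenPartialHomeomorph.continuousAt_symm
      ((e i).toOpenPartialHomeomorph.map_source (hsrc z hi))).tendsto.comp hl5
    have hinv : ∀ y ∈ (e i).source, (e i).toOpenPartialHomeomorph.symm (e i y) = y := fun y hy =>
      (e i).toOpenPartialHomeomorph.left_inv hy
    rw [show (e i).toOpenPartialHomeomorph.symm ((e i).toOpenPartialHomeomorph z) = z from
      hinv z (hsrc z hi)] at hl6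
    refine Filter.tendsto_id'.1 (hl6.congr' ?_)
    filter_upwards [hne] with y hy
    exact hinv y (hsrc y hy)
  · intro z z' hzz
    have hb : 𝓧.proj z = 𝓧.proj z' := by rw [← hfst, ← hfst, hzz]
    obtain ⟨i, hi⟩ := hc0 (𝓧.proj z)
    have h1 : c i (𝓧.proj z) • Q (f (e i z).2) = c i (𝓧.proj z') • Q (f (e i z').2) := by
      rw [← hproj, ← hproj, hzz]
    rw [← hb] at h1
    have h2 := hQ.isEmbedding.injective (smul_right_injective _ hi h1)
    refine (e i).injOn ((e i).mem_source.2 (hmem i _ hi))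
      ((e i).mem_source.2 (hb ▸ hmem i _ hi)) (Prod.ext ?_ h2)
    exact ((e i).coe_fst' (hmem i _ hi)).trans (hb.trans ((e i).coe_fst' (hb ▸ hmem i _ hi)).symm)
  · obtain ⟨i, hi⟩ := hc0 b
    obtain ⟨g, hg⟩ := exists_diffeomorph he' (he i) hb (hmem i b hi)
    refine SmoothEmb.of_clm_comp (hsmooth e' he' b hb) (P i) ?_
    convert (hQ.comp_diffeomorph g).const_smul hi using 2 with x
    rw [hproj, e'.proj_symm_apply' hb, hg]

end Glue

end ManifoldOver

/-! ### The Whitney embedding theorem -/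

section Whitney

variable {E : Type*} [NormedAddCommGroup E] [NormedSpace ℝ E]
  {H : Type*} [TopologicalSpace H] {I : ModelWithCorners ℝ E H}
  {X : Type*} [TopologicalSpace X] [ChartedSpace H X]
  {V : Type*} [NormedAddCommGroup V] [NormedSpace ℝ V]
  {W : Type*} [NormedAddCommGroup W] [NormedSpace ℝ W]

lemma mfderiv_clm_comp_apply {f : X → V} (hf : ContMDiff I 𝓘(ℝ, V) ∞ f) (L : V →L[ℝ] W) (x : X)
    (w : TangentSpace I x) :
    (show W from mfderiv I 𝓘(ℝ, W) (fun x => L (f x)) x w) =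
      L (show V from mfderiv I 𝓘(ℝ, V) f x w) := by
  have h := ((L.hasMFDerivAt (x := f x)).comp x
    (hf.mdifferentiableAt (x := x) (by simp)).hasMFDerivAt).mfderiv
  exact congrArg (fun M => M w) h

lemma injective_mfderiv_of_clm_comp_eventuallyEq {f : X → V} (hf : ContMDiff I 𝓘(ℝ, V) ∞ f) (L : V →L[ℝ] W) {g : X → W}
    {x : X} (hg : Injective (mfderiv I 𝓘(ℝ, W) g x)) (hfg : (fun y => L (f y)) =ᶠ[𝓝 x] g) :
    Injective (mfderiv I 𝓘(ℝ, V) f x) := by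
  refine (injective_iff_map_eq_zero _).2 fun w hw => ?_
  refine (injective_iff_map_eq_zero _).1 hg w ?_
  rw [← hfg.mfderiv_eq]
  refine (mfderiv_clm_comp_apply hf L x w).trans ?_
  exact (congrArg L hw).trans (map_zero L)

variable [IsManifold I ∞ X]

lemma mem_range_mfderiv_coord {f : X → V} (hf : ContMDiff I 𝓘(ℝ, V) ∞ f) {c x : X}
    (hx : x ∈ (chartAt H c).source) (w : TangentSpace I x) :
    ∃ w' : E, mfderiv I 𝓘(ℝ, V) f x w =
      fderivWithin ℝ (f ∘ (extChartAt I c).symm) (range I) (extChartAt I c x) w' := by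
  have h1 : DifferentiableWithinAt ℝ (f ∘ (extChartAt I c).symm) (range I) (extChartAt I c x) :=
    (contDiffWithinAt_coord_space hf (chart_mem_atlas H c) hx).differentiableWithinAt (by simp)
  have h2 := (mdifferentiableAt_extChartAt (I := I) hx).hasMFDerivAt.hasMFDerivWithinAt
    (s := univ)
  have h3 := (HasMFDerivWithinAt.comp x h1.hasFDerivWithinAt.hasMFDerivWithinAt h2
    (fun y _ => by simp)).hasMFDerivAt Filter.univ_mem
  have h4 : f =ᶠ[𝓝 x] (f ∘ (extChartAt I c).symm) ∘ extChartAt I c := by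
    filter_upwards [(chartAt H c).open_source.mem_nhds hx] with y hy
    simp only [Function.comp_apply]
    rw [(extChartAt I c).left_inv (by simpa using hy)]
  exact ⟨_, by rw [(h3.congr_of_eventuallyEq h4).mfderiv]; rfl⟩

variable [FiniteDimensional ℝ E]

lemma dimH_image_le_of_contDiffWithinAt {f : E → V} {s t : Set E} (hs : Convex ℝ s) (hts : t ⊆ s)
    (hf : ∀ x ∈ t, ContDiffWithinAt ℝ 1 f s x) : dimH (f '' t) ≤ Module.finrank ℝ E := by
  refine (dimH_image_le_of_locally_lipschitzOn fun x hx => ?_).trans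
    ((dimH_mono (subset_univ t)).trans_eq (Real.dimH_univ_eq_finrank E))
  obtain ⟨K, u, hu, hL⟩ := (hf x hx).exists_lipschitzOnWith hs
  exact ⟨K, u, nhdsWithin_mono x hts hu, hL⟩

/-- A generic direction along which an injective immersion can be projected. -/
lemma exists_projection_direction [SecondCountableTopology X] [FiniteDimensional ℝ V] {f : X → V}
    (hf : ContMDiff I 𝓘(ℝ, V) ∞ f) {S : Set X} (hinj : InjOn f S)
    (himm : ∀ x ∈ S, Injective (mfderiv I 𝓘(ℝ, V) f x))
    (hd : 2 * Module.finrank ℝ E + 1 < Module.finrank ℝ V) :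
    ∃ v : V, v ≠ 0 ∧
      (∀ x ∈ S, ∀ y ∈ S, f x - f y ∈ Submodule.span ℝ {v} → x = y) ∧
      ∀ x ∈ S, ∀ w : TangentSpace I x,
        (show V from mfderiv I 𝓘(ℝ, V) f x w) ∈ Submodule.span ℝ {v} → w = 0 := by
  obtain ⟨C, hC, hCu⟩ := TopologicalSpace.countable_cover_nhds
    (fun x : X => chart_source_mem_nhds H x)
  have := hC.to_subtype
  have hcover : ∀ x : X, ∃ c : C, x ∈ (chartAt H c.1).source := fun x => by
    have := hCu ▸ mem_univ x
    simpa using this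
  have hconv : Convex ℝ (range I) := I.convex_range
  have hcoord : ∀ (c : X), ∀ v ∈ (extChartAt I c).target,
      ContDiffWithinAt ℝ ∞ (f ∘ (extChartAt I c).symm) (range I) v := by
    intro c v hv
    have h1 := (extChartAt I c).map_target hv
    rw [extChartAt_source] at h1
    have h2 := contDiffWithinAt_coord_space hf (chart_mem_atlas H c) h1
    change ContDiffWithinAt ℝ ∞ _ _ (extChartAt I c _) at h2
    rwa [(extChartAt I c).right_inv hv] at h2
  have htr : ∀ c : X, (extChartAt I c).target ⊆ range I := fun c => extChartAt_target_subset_range c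
  set s₁ : C × C → Set V := fun c => (fun p : ℝ × E × E =>
    p.1 • ((f ∘ (extChartAt I c.1.1).symm) p.2.1 - (f ∘ (extChartAt I c.2.1).symm) p.2.2)) ''
      (univ ×ˢ (extChartAt I c.1.1).target ×ˢ (extChartAt I c.2.1).target) with hs₁
  set s₂ : C → Set V := fun c => (fun p : E × E =>
    fderivWithin ℝ (f ∘ (extChartAt I c.1).symm) (range I) p.1 p.2) ''
      ((extChartAt I c.1).target ×ˢ univ) with hs₂
  have hd₁ : dimH (⋃ c, s₁ c) < Module.finrank ℝ V := by
    rw [dimH_iUnion]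
    refine lt_of_le_of_lt (iSup_le fun c => dimH_image_le_of_contDiffWithinAt
      (s := univ ×ˢ range I ×ˢ range I) (convex_univ.prod (hconv.prod hconv)) ?_ ?_)
      (show ((Module.finrank ℝ (ℝ × E × E) : ℕ) : ENNReal) < _ from ?_)
    · exact prod_mono subset_rfl (prod_mono (htr _) (htr _))
    · rintro ⟨t, v, v'⟩ ⟨-, hv, hv'⟩
      have h1 := (hcoord _ v hv).comp (t, v, v') (f := fun p : ℝ × E × E => p.2.1)
        (s := univ ×ˢ range I ×ˢ range I) (by fun_prop) (fun p hp => hp.2.1)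
      have h2 := (hcoord _ v' hv').comp (t, v, v') (f := fun p : ℝ × E × E => p.2.2)
        (s := univ ×ˢ range I ×ˢ range I) (by fun_prop) (fun p hp => hp.2.2)
      exact (contDiffWithinAt_fst.smul (h1.sub h2)).of_le (by exact_mod_cast le_top)
    · rw [Module.finrank_prod, Module.finrank_prod, Module.finrank_self]
      exact_mod_cast (by omega)
  have hd₂ : dimH (⋃ c, s₂ c) < Module.finrank ℝ V := by
    rw [dimH_iUnion]
    refine lt_of_le_of_lt (iSup_le fun c => dimH_image_le_of_contDiffWithinAt
      (s := range I ×ˢ univ) (hconv.prod convex_univ) ?_ ?_)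
      (show ((Module.finrank ℝ (E × E) : ℕ) : ENNReal) < _ from ?_)
    · exact prod_mono (htr _) subset_rfl
    · rintro ⟨v, w⟩ ⟨hv, -⟩
      have h0 := (hcoord _ v hv).fderivWithin_right (m := 1) I.uniqueDiffOn (by norm_cast)
        (htr _ hv)
      have h1 := h0.comp (v, w) (f := fun p : E × E => p.1) (s := range I ×ˢ univ) (by fun_prop)
        (fun p hp => hp.1)
      exact h1.clm_apply contDiffWithinAt_snd
    · rw [Module.finrank_prod]
      exact_mod_cast (by omega)
  have hdense := dense_compl_of_dimH_lt_finrank (s := (⋃ c, s₁ c) ∪ ⋃ c, s₂ c)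
    (by rw [dimH_union]; exact max_lt hd₁ hd₂)
  have hnt : Nontrivial V := Module.nontrivial_of_finrank_pos (R := ℝ) (by omega)
  obtain ⟨v, hv0, hv⟩ := hdense.inter_open_nonempty {0}ᶜ isOpen_compl_singleton
    (exists_ne (0 : V))
  have hv₁ : ∀ (t : ℝ) (x y : X), v ≠ t • (f x - f y) := by
    rintro t x y rfl
    obtain ⟨c, hc⟩ := hcover x
    obtain ⟨c', hc'⟩ := hcover y
    refine hv (Or.inl (mem_iUnion.2 ⟨(c, c'), (t, extChartAt I c.1 x, extChartAt I c'.1 y),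
      ⟨mem_univ _, (extChartAt I c.1).map_source (by simpa using hc),
        (extChartAt I c'.1).map_source (by simpa using hc')⟩, ?_⟩))
    simp only [Function.comp_apply]
    rw [(extChartAt I c.1).left_inv (by simpa using hc),
      (extChartAt I c'.1).left_inv (by simpa using hc')]
  have hv₂ : ∀ (x : X) (w : TangentSpace I x), v ≠ mfderiv I 𝓘(ℝ, V) f x w := by
    intro x w hvw
    obtain ⟨c, hc⟩ := hcover x
    obtain ⟨w', hw'⟩ := mem_range_mfderiv_coord hf hc w
    exact hv (Or.inr (mem_iUnion.2 ⟨c, (extChartAt I c.1 x, w'),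
      ⟨(extChartAt I c.1).map_source (by simpa using hc), mem_univ _⟩, (hvw.trans hw').symm⟩))
  refine ⟨v, hv0, fun x hx y hy h => ?_, fun x hx w h => ?_⟩
  · obtain ⟨a, ha⟩ := Submodule.mem_span_singleton.1 h
    rcases eq_or_ne a 0 with rfl | ha0
    · rw [zero_smul] at ha
      exact hinj hx hy (sub_eq_zero.1 ha.symm)
    · exact absurd (by rw [← ha, inv_smul_smul₀ ha0]) (hv₁ a⁻¹ x y)
  · obtain ⟨a, ha⟩ := Submodule.mem_span_singleton.1 h
    rcases eq_or_ne a 0 with rfl | ha0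
    · rw [zero_smul] at ha
      exact himm x hx (ha.symm.trans (map_zero _).symm)
    · refine absurd ?_ (hv₂ x (a⁻¹ • w))
      rw [map_smul]
      exact ((inv_smul_smul₀ ha0 v).symm.trans (congrArg (a⁻¹ • ·) ha))

lemma exists_clm_ker_eq_span [FiniteDimensional ℝ V] {v : V} (hv : v ≠ 0) {d : ℕ}
    (hd : Module.finrank ℝ V = d + 1) :
    ∃ L : V →L[ℝ] EuclideanSpace ℝ (Fin d), ∀ x, L x = 0 → x ∈ Submodule.span ℝ {v} := by
  have h1 : Module.finrank ℝ (V ⧸ Submodule.span ℝ {v}) =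
      Module.finrank ℝ (EuclideanSpace ℝ (Fin d)) := by
    have := Submodule.finrank_quotient_add_finrank (Submodule.span ℝ {v})
    rw [finrank_span_singleton hv, hd] at this
    rw [finrank_euclideanSpace_fin]
    omega
  let e := LinearEquiv.ofFinrankEq _ _ h1
  refine ⟨LinearMap.toContinuousLinearMap (e.toLinearMap ∘ₗ (Submodule.span ℝ {v}).mkQ),
    fun x hx => ?_⟩
  have hx' : e ((Submodule.span ℝ {v}).mkQ x) = 0 := hx
  rw [LinearEquiv.map_eq_zero_iff] at hx'
  exact (Submodule.Quotient.mk_eq_zero _).1 hx'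

/-- A map that is an injective immersion along a set can be replaced by one to a space of
dimension `2 n + 1`. -/
lemma exists_injective_immersion_reduce [SecondCountableTopology X] {S : Set X} (d : ℕ)
    {f : X → EuclideanSpace ℝ (Fin d)} (hf : ContMDiff I 𝓘(ℝ, EuclideanSpace ℝ (Fin d)) ∞ f)
    (hinj : InjOn f S) (himm : ∀ x ∈ S, Injective (mfderiv I 𝓘(ℝ, EuclideanSpace ℝ (Fin d)) f x)) :
    ∃ g : X → EuclideanSpace ℝ (Fin (2 * Module.finrank ℝ E + 1)),
      ContMDiff I 𝓘(ℝ, EuclideanSpace ℝ (Fin (2 * Module.finrank ℝ E + 1))) ∞ g ∧ InjOn g S ∧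
      ∀ x ∈ S, Injective
        (mfderiv I 𝓘(ℝ, EuclideanSpace ℝ (Fin (2 * Module.finrank ℝ E + 1))) g x) := by
  induction d with
  | zero =>
    refine ⟨fun x => (0 : EuclideanSpace ℝ (Fin 0) →L[ℝ] _) (f x),
      (ContinuousLinearMap.contMDiff _).comp hf, fun x hx y hy _ =>
        hinj hx hy (Subsingleton.elim _ _), fun x hx w w' _ =>
        himm x hx (Subsingleton.elim (α := EuclideanSpace ℝ (Fin 0)) _ _)⟩
  | succ d ih =>
    by_cases hd : 2 * Module.finrank ℝ E + 1 < d + 1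
    · obtain ⟨v, hv, h1, h2⟩ := exists_projection_direction hf hinj himm
        (by rwa [finrank_euclideanSpace_fin])
      obtain ⟨L, hL⟩ := exists_clm_ker_eq_span hv finrank_euclideanSpace_fin
      refine ih (f := fun x => L (f x)) (L.contMDiff.comp hf) (fun x hx y hy hxy => ?_)
        (fun x hx => ?_)
      · exact h1 x hx y hy (hL _ (by rw [map_sub]; exact sub_eq_zero.2 hxy))
      · exact (injective_iff_map_eq_zero _).2 fun w hw =>
          h2 x hx w (hL _ ((mfderiv_clm_comp_apply hf L x w).symm.trans hw))
    · obtain ⟨L, hL⟩ : ∃ L : EuclideanSpace ℝ (Fin (d + 1)) →ₗ[ℝ]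
          EuclideanSpace ℝ (Fin (2 * Module.finrank ℝ E + 1)), Injective L :=
        finrank_le_iff_exists_linearMap.1 (by simpa using hd)
      set L' := LinearMap.toContinuousLinearMap L
      refine ⟨fun x => L' (f x), L'.contMDiff.comp hf,
        fun x hx y hy hxy => hinj hx hy (hL hxy), fun x hx w w' hw => himm x hx (hL ?_)⟩
      have h := mfderiv_clm_comp_apply hf L' x
      refine ((h w).symm.trans ?_ : L' _ = L' _)
      rw [← h w']
      exact hw

end Whitney

section WhitneyProper

variable {E : Type*} [NormedAddCommGroup E] [NormedSpace ℝ E]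
  {H : Type*} [TopologicalSpace H] {I : ModelWithCorners ℝ E H}
  {X : Type*} [TopologicalSpace X] [ChartedSpace H X]
  {V : Type*} [NormedAddCommGroup V] [NormedSpace ℝ V]

/-- Maps that are injective immersions along the sublevel sets of a smooth exhaustion combine to an
embedding. -/
lemma exists_smoothEmb_of_exhaustion {p : X → ℝ} (hp : ContMDiff I 𝓘(ℝ, ℝ) ∞ p)
    (hp0 : ∀ x, 0 ≤ p x) (hpc : ∀ a : ℝ, IsCompact {x | p x ≤ a}) {g : ℕ → X → V}
    (hg : ∀ j, ContMDiff I 𝓘(ℝ, V) ∞ (g j)) (hginj : ∀ j : ℕ, InjOn (g j) {x | p x ≤ j + 1})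
    (hgimm : ∀ j : ℕ, ∀ x, p x ≤ j + 1 → Injective (mfderiv I 𝓘(ℝ, V) (g j) x)) :
    ∃ f : X → ℝ × V × V, SmoothEmb I 𝓘(ℝ, ℝ × V × V) f := by
  let χ : ContDiffBump (0 : ℝ) := ⟨2 / 3, 1, by norm_num, by norm_num⟩
  have hχ0 : ∀ t : ℝ, χ t ≠ 0 → |t| < 1 := fun t ht => by
    have : t ∈ support χ := ht
    rw [χ.support_eq] at this
    simpa using this
  have hχ1 : ∀ t : ℝ, |t| ≤ 2 / 3 → χ t = 1 := fun t ht =>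
    χ.one_of_mem_closedBall (by simpa using ht)
  let φ : ℕ → ℕ → X → V := fun ε k x => χ (p x - (2 * k + ε : ℕ)) • g (2 * k + ε) x
  let G : ℕ → X → V := fun ε x => ∑ᶠ k : ℕ, φ ε k x
  have hGsmooth : ∀ ε, ContMDiff I 𝓘(ℝ, V) ∞ (G ε) := fun ε => by
    refine contMDiff_finsum (fun k => ?_) fun x => ?_
    · have h1 : ContMDiff I 𝓘(ℝ, ℝ) ∞ (fun x => χ (p x - (2 * k + ε : ℕ))) :=
        (χ.contDiff.comp (contDiff_id.sub contDiff_const)).contMDiff.comp hp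
      exact h1.smul (hg _)
    · refine ⟨{y | p y < p x + 1},
        (isOpen_lt hp.continuous continuous_const).mem_nhds (by simp), ?_⟩
      refine (finite_Iic ⌊p x + 2⌋₊).subset ?_
      rintro k ⟨y, hy, hyx⟩
      have h1 := abs_lt.1 (hχ0 _ (left_ne_zero_of_smul hy))
      have h2 : p y < p x + 1 := hyx
      refine Nat.le_floor ?_
      have h3 := h1.1
      push_cast at h3
      have : (0 : ℝ) ≤ ε := Nat.cast_nonneg _
      have : (0 : ℝ) ≤ k := Nat.cast_nonneg _
      linarith
  have hG : ∀ ε k x, |p x - (2 * k + ε : ℕ)| ≤ 2 / 3 → G ε x = g (2 * k + ε) x := by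
    intro ε k x hx
    show ∑ᶠ k : ℕ, φ ε k x = _
    rw [finsum_eq_single _ k]
    · show χ _ • _ = _
      rw [hχ1 _ hx, one_smul]
    · intro k' hk'
      by_contra h
      have h1 := abs_lt.1 (hχ0 _ (left_ne_zero_of_smul h))
      have h2 := abs_le.1 hx
      push_cast at h1 h2
      have h3 : (k : ℝ) < k' + 1 := by linarith
      have h4 : (k' : ℝ) < k + 1 := by linarith
      norm_cast at h3 h4
      omega
  let f : X → ℝ × V × V := fun x => (p x, G 0 x, G 1 x)
  have hf : ContMDiff I 𝓘(ℝ, ℝ × V × V) ∞ f :=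
    hp.prodMk_space ((hGsmooth 0).prodMk_space (hGsmooth 1))
  have hloc : ∀ x, ∃ (j : ℕ) (L : ℝ × V × V →L[ℝ] V), |p x - j| ≤ 1 / 2 ∧
      ∀ y, |p y - j| ≤ 2 / 3 → L (f y) = g j y := by
    intro x
    obtain ⟨j, hj⟩ : ∃ j : ℕ, |p x - j| ≤ 1 / 2 := by
      refine ⟨⌊p x + 1 / 2⌋₊, abs_le.2 ⟨?_, ?_⟩⟩
      · linarith [Nat.floor_le (show 0 ≤ p x + 1 / 2 by linarith [hp0 x])]
      · linarith [Nat.lt_floor_add_one (p x + 1 / 2)]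
    rcases Nat.even_or_odd' j with ⟨k, rfl | rfl⟩
    · exact ⟨_, (ContinuousLinearMap.fst ℝ V V).comp (ContinuousLinearMap.snd ℝ ℝ (V × V)), hj,
        fun y hy => hG 0 k y hy⟩
    · exact ⟨_, (ContinuousLinearMap.snd ℝ V V).comp (ContinuousLinearMap.snd ℝ ℝ (V × V)), hj,
        fun y hy => hG 1 k y hy⟩
  have hfinj : Injective f := by
    intro x y hxy
    obtain ⟨j, L, hj, hL⟩ := hloc x
    have hpxy : p x = p y := congrArg Prod.fst hxy
    have hx := hL x (hj.trans (by norm_num))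
    have hy := hL y (by rw [← hpxy]; exact hj.trans (by norm_num))
    have hle : p x ≤ j + 1 := by linarith [(abs_le.1 hj).2]
    exact hginj j hle (hpxy ▸ hle : p y ≤ j + 1) (by rw [← hx, ← hy, hxy])
  refine ⟨f, hf, fun x => ?_, ?_⟩
  · obtain ⟨j, L, hj, hL⟩ := hloc x
    refine injective_mfderiv_of_clm_comp_eventuallyEq hf L (hgimm j x ?_) ?_
    · linarith [(abs_le.1 hj).2]
    · have h1 : ∀ᶠ y in 𝓝 x, |p y - j| < 2 / 3 :=
        (hp.continuous.sub continuous_const).abs.continuousAt.eventually_lt_const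
          (hj.trans_lt (by norm_num))
      filter_upwards [h1] with y hy
      exact hL y hy.le
  · have hprop : IsProperMap f := by
      rw [isProperMap_iff_isCompact_preimage]
      refine ⟨hf.continuous, fun C hC => ?_⟩
      obtain ⟨a, ha⟩ := (hC.image continuous_fst).bddAbove
      exact (hpc a).of_isClosed_subset (hC.isClosed.preimage hf.continuous) fun x hx =>
        ha (mem_image_of_mem Prod.fst hx)
    exact (IsClosedEmbedding.of_continuous_injective_isClosedMap hf.continuous hfinj
      hprop.isClosedMap).isEmbedding

variable [FiniteDimensional ℝ E] [IsManifold I ∞ X] [T2Space X]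

/-- A compact set has a smooth map to a Euclidean space that is an injective immersion along it. -/
lemma exists_injective_immersion_of_isCompact {K : Set X} (hK : IsCompact K) :
    ∃ (d : ℕ) (f : X → EuclideanSpace ℝ (Fin d)),
      ContMDiff I 𝓘(ℝ, EuclideanSpace ℝ (Fin d)) ∞ f ∧ InjOn f K ∧
      ∀ x ∈ K, Injective (mfderiv I 𝓘(ℝ, EuclideanSpace ℝ (Fin d)) f x) := by
  let β : ∀ c : X, SmoothBumpFunction I c := fun c => Classical.arbitrary _
  obtain ⟨t, -, ht⟩ := hK.elim_nhds_subcover (fun c => {x | β c =ᶠ[𝓝 x] 1})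
    (fun c _ => (β c).eventuallyEq_one.eventually_nhds)
  let F : X → (t → E × ℝ) := fun x c => (β c x • extChartAt I c.1 x, β c x)
  have hF : ContMDiff I 𝓘(ℝ, t → E × ℝ) ∞ F := contMDiff_pi_space.2 fun c =>
    ((β c).contMDiff_smul contMDiffOn_extChartAt).prodMk_space (β c).contMDiff
  have hcov : ∀ x ∈ K, ∃ c : t, β c =ᶠ[𝓝 x] 1 := fun x hx => by
    obtain ⟨c, hc, hxc⟩ := mem_iUnion₂.1 (ht hx)
    exact ⟨⟨c, hc⟩, hxc⟩
  have hsrc : ∀ (c x : X), β c x = 1 → x ∈ (chartAt H c).source := fun c x hx =>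
    (β c).support_subset_source (by simp [hx])
  have hFinj : InjOn F K := by
    intro x hx y hy hxy
    obtain ⟨c, hc⟩ := hcov x hx
    obtain ⟨h1, h2⟩ := Prod.mk_inj.1 (congrFun hxy c)
    have hcx : β c x = 1 := hc.self_of_nhds
    have hcy : β c y = 1 := h2.symm.trans hcx
    rw [hcx, hcy, one_smul, one_smul] at h1
    exact (extChartAt I c.1).injOn (by simpa using hsrc _ _ hcx) (by simpa using hsrc _ _ hcy) h1
  have hFimm : ∀ x ∈ K, Injective (mfderiv I 𝓘(ℝ, t → E × ℝ) F x) := by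
    intro x hx
    obtain ⟨c, hc⟩ := hcov x hx
    have hxc : x ∈ (extChartAt I c.1).source := by simpa using hsrc _ _ hc.self_of_nhds
    refine injective_mfderiv_of_clm_comp_eventuallyEq hF
      ((ContinuousLinearMap.fst ℝ E ℝ).comp (ContinuousLinearMap.proj c))
      (g := extChartAt I c.1) (isInvertible_mfderiv_extChartAt hxc).injective ?_
    filter_upwards [hc] with y hy
    show β c y • extChartAt I c.1 y = _
    rw [hy, Pi.one_apply, one_smul]
  let L : (t → E × ℝ) ≃L[ℝ] EuclideanSpace ℝ (Fin (Module.finrank ℝ (t → E × ℝ))) :=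
    ContinuousLinearEquiv.ofFinrankEq finrank_euclideanSpace_fin.symm
  have hLF : ContMDiff I 𝓘(ℝ, EuclideanSpace ℝ (Fin (Module.finrank ℝ (t → E × ℝ)))) ∞
      (fun x => L (F x)) :=
    (L : (t → E × ℝ) →L[ℝ]
      EuclideanSpace ℝ (Fin (Module.finrank ℝ (t → E × ℝ)))).contMDiff.comp hF
  refine ⟨_, fun x => L (F x), hLF, fun x hx y hy hxy => hFinj hx hy (L.injective hxy),
    fun x hx => ?_⟩
  exact injective_mfderiv_of_clm_comp_eventuallyEq hLF (L.symm : _ →L[ℝ] (t → E × ℝ)) (hFimm x hx)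
    (Filter.Eventually.of_forall fun y => L.symm_apply_apply _)

variable [SecondCountableTopology X]

variable (I X) in
lemma exists_smooth_exhaustion :
    ∃ p : X → ℝ, ContMDiff I 𝓘(ℝ, ℝ) ∞ p ∧ (∀ x, 0 ≤ p x) ∧ ∀ a : ℝ, IsCompact {x | p x ≤ a} := by
  have : LocallyCompactSpace X := Manifold.locallyCompact_of_finiteDimensional I
  let K : CompactExhaustion X := default
  obtain ⟨p, hp⟩ := exists_contMDiffMap_forall_mem_convex_of_local_const (n := ⊤) I
    (t := fun x : X => Ici (K.find x : ℝ)) (fun x => convex_Ici _) (fun x => by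
      refine ⟨(K.find x + 1 : ℕ), ?_⟩
      filter_upwards [isOpen_interior.mem_nhds (K.subset_interior_succ _ (K.mem_find x))] with y hy
      exact mem_Ici.2 (Nat.cast_le.2 (K.mem_iff_find_le.1 (interior_subset hy))))
  refine ⟨p, p.contMDiff, fun x => (Nat.cast_nonneg _).trans (hp x), fun a => ?_⟩
  refine (K.isCompact ⌊a⌋₊).of_isClosed_subset
    (isClosed_le p.contMDiff.continuous continuous_const) fun x hx => ?_
  exact K.mem_iff_find_le.2 (Nat.le_floor ((hp x).trans hx))

/-- **Whitney embedding theorem**: a second countable Hausdorff manifold, not necessarily compact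
and possibly with boundary, has a smooth embedding in a finite-dimensional space. -/
theorem exists_smoothEmb :
    ∃ (d : ℕ) (f : X → ℝ × EuclideanSpace ℝ (Fin d) × EuclideanSpace ℝ (Fin d)),
      SmoothEmb I 𝓘(ℝ, ℝ × EuclideanSpace ℝ (Fin d) × EuclideanSpace ℝ (Fin d)) f := by
  obtain ⟨p, hp, hp0, hpc⟩ := exists_smooth_exhaustion I X
  have hpiece : ∀ j : ℕ, ∃ g : X → EuclideanSpace ℝ (Fin (2 * Module.finrank ℝ E + 1)),
      ContMDiff I 𝓘(ℝ, EuclideanSpace ℝ (Fin (2 * Module.finrank ℝ E + 1))) ∞ g ∧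
      InjOn g {x | p x ≤ j + 1} ∧ ∀ x, p x ≤ j + 1 → Injective
        (mfderiv I 𝓘(ℝ, EuclideanSpace ℝ (Fin (2 * Module.finrank ℝ E + 1))) g x) := fun j => by
    obtain ⟨d, f, hf, h1, h2⟩ := exists_injective_immersion_of_isCompact (I := I) (hpc (j + 1))
    exact exists_injective_immersion_reduce d hf h1 h2
  choose g hg hginj hgimm using hpiece
  exact ⟨_, exists_smoothEmb_of_exhaustion hp hp0 hpc hg hginj hgimm⟩

end WhitneyProper

/-! ### Functions that define the boundary -/

section BoundaryFunction

variable {E : Type*} [NormedAddCommGroup E] [NormedSpace ℝ E]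
  {H : Type*} [TopologicalSpace H] {I : ModelWithCorners ℝ E H} [HalfSpaceModel I]
  {X : Type*} [TopologicalSpace X]

lemma form_extend_nonneg (φ : OpenPartialHomeomorph X H) (x : X) :
    0 ≤ HalfSpaceModel.form I (φ.extend I x) := by
  have h : φ.extend I x ∈ range I := by simp
  rwa [HalfSpaceModel.range_eq (I := I)] at h

variable [ChartedSpace H X]

lemma mfderiv_nonneg_of_isMin {r : X → ℝ} {x : X} (hr : MDifferentiableAt I 𝓘(ℝ, ℝ) r x)
    (hx : ∀ y, r x ≤ r y) {w : E} (hw : 0 ≤ HalfSpaceModel.form I w) :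
    (0 : ℝ) ≤ (show E →L[ℝ] ℝ from mfderiv I 𝓘(ℝ, ℝ) r x) w := by
  have hd : HasFDerivWithinAt (writtenInExtChartAt I 𝓘(ℝ, ℝ) x r)
      (show E →L[ℝ] ℝ from mfderiv I 𝓘(ℝ, ℝ) r x) (range I) (extChartAt I x x) :=
    hr.hasMFDerivAt.2
  have hmin : IsLocalMinOn (writtenInExtChartAt I 𝓘(ℝ, ℝ) x r) (range I) (extChartAt I x x) := by
    refine Filter.Eventually.of_forall fun v => ?_
    simpa [writtenInExtChartAt, chartAt_self_eq] using hx _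
  refine hmin.hasFDerivWithinAt_nonneg hd (mem_posTangentConeAt_of_segment_subset ?_)
  refine I.convex_range.segment_subset (by simp) ?_
  have h1 : extChartAt I x x ∈ range I := by simp
  rw [HalfSpaceModel.range_eq (I := I)] at h1 ⊢
  show 0 ≤ HalfSpaceModel.form I (extChartAt I x x + w)
  rw [map_add]
  exact add_nonneg h1 hw

/-- A nonnegative function that vanishes at a point has a nonzero differential there if this is so
for a nonnegative function below it. -/
lemma exists_mfderiv_ne_zero_of_le {r s : X → ℝ} {x : X} (hr : MDifferentiableAt I 𝓘(ℝ, ℝ) r x)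
    (hs : MDifferentiableAt I 𝓘(ℝ, ℝ) s x) (hsr : ∀ y, s y ≤ r y) (hs0 : ∀ y, 0 ≤ s y)
    (hx : r x = 0) (hds : ∃ w : E, (show E →L[ℝ] ℝ from mfderiv I 𝓘(ℝ, ℝ) s x) w ≠ 0) :
    ∃ w : E, (show E →L[ℝ] ℝ from mfderiv I 𝓘(ℝ, ℝ) r x) w ≠ 0 := by
  have hsx : s x = 0 := le_antisymm (hx ▸ hsr x) (hs0 x)
  obtain ⟨w, hw0, hw⟩ : ∃ w : E, 0 ≤ HalfSpaceModel.form I w ∧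
      (show E →L[ℝ] ℝ from mfderiv I 𝓘(ℝ, ℝ) s x) w ≠ 0 := by
    obtain ⟨w, hw⟩ := hds
    rcases le_total 0 (HalfSpaceModel.form I w) with h | h
    · exact ⟨w, h, hw⟩
    · exact ⟨-w, by rw [map_neg]; exact neg_nonneg.2 h, by rw [map_neg]; exact neg_ne_zero.2 hw⟩
  have h1 := mfderiv_nonneg_of_isMin hs (fun y => hsx ▸ hs0 y) hw0
  have h2 := mfderiv_nonneg_of_isMin (r := r - s) (hr.sub hs)
    (fun y => by simpa [hx, hsx] using hsr y) hw0
  rw [mfderiv_sub hr hs] at h2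
  have h3 : (0 : ℝ) ≤ (show E →L[ℝ] ℝ from mfderiv I 𝓘(ℝ, ℝ) r x) w -
    (show E →L[ℝ] ℝ from mfderiv I 𝓘(ℝ, ℝ) s x) w := h2
  exact ⟨w, ((lt_of_le_of_ne h1 (Ne.symm hw)).trans_le (sub_nonneg.1 h3)).ne'⟩

variable (I X) in
/-- A smooth nonnegative function that vanishes exactly on the boundary, with nonzero differential
there. -/
lemma exists_boundary_defining_function [FiniteDimensional ℝ E] [IsManifold I ∞ X] [T2Space X]
    [SigmaCompactSpace X] :
    ∃ ρ : X → ℝ, ContMDiff I 𝓘(ℝ, ℝ) ∞ ρ ∧ (∀ x, 0 ≤ ρ x) ∧ (∀ x, ρ x = 0 ↔ x ∈ I.boundary X) ∧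
      ∀ x ∈ I.boundary X, ∃ w : E, (show E →L[ℝ] ℝ from mfderiv I 𝓘(ℝ, ℝ) ρ x) w ≠ 0 := by
  by_cases h0 : HalfSpaceModel.form I = 0
  · refine ⟨fun _ => 1, contMDiff_const, fun _ => zero_le_one, fun x => ?_, fun x hx => ?_⟩
    · exact ⟨fun h => absurd h one_ne_zero, fun hx => absurd h0 (form_ne_zero_of_mem_boundary (X := X) hx)⟩
    · exact absurd h0 (form_ne_zero_of_mem_boundary (X := X) hx)
  obtain ⟨χ, hχ⟩ := SmoothPartitionOfUnity.exists_isSubordinate_chartAt_source I X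
  let s : X → X → ℝ := fun c x => χ c x • HalfSpaceModel.form I (extChartAt I c x)
  have hform : ∀ (c x : X), 0 ≤ HalfSpaceModel.form I (extChartAt I c x) := fun c x =>
    form_extend_nonneg (I := I) (chartAt H c) x
  have hs0 : ∀ c x, 0 ≤ s c x := fun c x => mul_nonneg (χ.nonneg c x) (hform c x)
  have hcoord : ∀ c : X, ∀ x ∈ (chartAt H c).source,
      ContMDiffAt I 𝓘(ℝ, ℝ) ∞ (fun x => HalfSpaceModel.form I (extChartAt I c x)) x :=
    fun c x hx => (HalfSpaceModel.form I).contMDiff.contMDiffAt.comp x (contMDiffAt_extChartAt' hx)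
  have hs : ∀ c : X, ContMDiff I 𝓘(ℝ, ℝ) ∞ (s c) := fun c =>
    χ.contMDiff_smul (i := c) (g := fun x => HalfSpaceModel.form I (extChartAt I c x))
      fun x hx => hcoord c x (hχ c hx)
  have hρ : ContMDiff I 𝓘(ℝ, ℝ) ∞ (fun x => ∑ᶠ c, s c x) :=
    χ.contMDiff_finsum_smul fun c x hx => hcoord c x (hχ c hx)
  have hle : ∀ c x, s c x ≤ ∑ᶠ c, s c x := fun c x =>
    single_le_finsum c ((χ.locallyFinite.point_finite x).subset fun c hc =>
      left_ne_zero_of_smul hc) fun c => hs0 c x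
  have hsrc : ∀ c x, χ c x ≠ 0 → x ∈ (chartAt H c).source := fun c x h =>
    hχ c (subset_tsupport _ h)
  have hzero : ∀ x, ∑ᶠ c, s c x = 0 ↔ x ∈ I.boundary X := by
    intro x
    constructor
    · intro hx
      obtain ⟨c, hc⟩ := χ.exists_pos_of_mem (mem_univ x)
      have h1 : s c x = 0 := le_antisymm (hx ▸ hle c x) (hs0 c x)
      exact (mem_boundary_iff_form h0 (chart_mem_atlas H c) (hsrc c x hc.ne')).2
        ((mul_eq_zero.1 h1).resolve_left hc.ne')
    · intro hx
      rw [finsum_eq_zero_of_forall_eq_zero]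
      intro c
      by_cases hc : χ c x = 0
      · show χ c x • _ = 0
        rw [hc, zero_smul]
      · show χ c x • _ = 0
        rw [show HalfSpaceModel.form I (extChartAt I c x) = 0 from
          (mem_boundary_iff_form h0 (chart_mem_atlas H c) (hsrc c x hc)).1 hx, smul_zero]
  refine ⟨_, hρ, fun x => finsum_nonneg fun c => hs0 c x, hzero, fun x hx => ?_⟩
  obtain ⟨c, hc⟩ := χ.exists_pos_of_mem (mem_univ x)
  refine exists_mfderiv_ne_zero_of_le (hρ.mdifferentiableAt (by simp))
    ((hs c).mdifferentiableAt (by simp)) (hle c) (hs0 c) ((hzero x).2 hx) ?_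
  have hcx := hsrc c x hc.ne'
  have hfx : HalfSpaceModel.form I (extChartAt I c x) = 0 :=
    (mem_boundary_iff_form h0 (chart_mem_atlas H c) hcx).1 hx
  obtain ⟨v, hv⟩ : ∃ v, HalfSpaceModel.form I v ≠ 0 := by
    by_contra! h
    exact h0 (ContinuousLinearMap.ext h)
  have hinv := isInvertible_mfderiv_extChartAt (I := I) (x := c) (y := x) (by simpa using hcx)
  obtain ⟨w, hw⟩ := hinv.surjective v
  have hd1 := ((χ c).contMDiff.mdifferentiableAt (x := x) (by simp)).hasMFDerivAt
  have hd2 := (HalfSpaceModel.form I).hasMFDerivAt (x := extChartAt I c x) |>.comp x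
    (mdifferentiableAt_extChartAt (I := I) hcx).hasMFDerivAt
  have hd3 := (hd1.mul hd2).mfderiv
  refine ⟨w, ?_⟩
  have hd4 : (show E →L[ℝ] ℝ from mfderiv I 𝓘(ℝ, ℝ) (s c) x) w =
      χ c x • HalfSpaceModel.form I (show E from mfderiv I 𝓘(ℝ, E) (extChartAt I c) x w) +
        HalfSpaceModel.form I (extChartAt I c x) •
          (show E →L[ℝ] ℝ from mfderiv I 𝓘(ℝ, ℝ) (χ c) x) w :=
    congrArg (fun M : E →L[ℝ] ℝ => M w) hd3
  rw [hd4, hfx, zero_smul, add_zero]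
  refine mul_ne_zero hc.ne' ?_
  rw [show (show E from mfderiv I 𝓘(ℝ, E) (extChartAt I c) x w) = v from hw]
  exact hv

variable [FiniteDimensional ℝ E] [IsManifold I ∞ X]

lemma injective_mfderiv_boundary_val (x : I.boundary X) :
    Injective (mfderiv 𝓘(ℝ, BoundaryModel I) I (Subtype.val : I.boundary X → X) x) := by
  have h1 := (contMDiff_boundary_val (I := I) (X := X)).mdifferentiableAt (x := x) (by simp)
  have h2 := (mdifferentiableAt_extChartAt (I := I) (mem_chart_source H x.1)).hasMFDerivAt.comp x
    h1.hasMFDerivAt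
  have h3 := ((boundaryProj I).hasMFDerivAt (x := extChartAt I x.1 x.1)).comp x h2
  have h4 := (isInvertible_mfderiv_extChartAt
    (mem_extChartAt_source (I := 𝓘(ℝ, BoundaryModel I)) x)).injective
  have h5 : boundaryProj I ∘ extChartAt I x.1 ∘ Subtype.val =
      extChartAt 𝓘(ℝ, BoundaryModel I) x := rfl
  rw [← h5, h3.mfderiv] at h4
  exact Injective.of_comp (f := (boundaryProj I : E → BoundaryModel I) ∘
    mfderiv I 𝓘(ℝ, E) (extChartAt I x.1) x.1) h4

lemma SmoothEmb.comp_boundary_val {W : Type*} [NormedAddCommGroup W] [NormedSpace ℝ W]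
    {f : X → W} (h : SmoothEmb I 𝓘(ℝ, W) f) :
    SmoothEmb 𝓘(ℝ, BoundaryModel I) 𝓘(ℝ, W) (fun x : I.boundary X => f x) where
  contMDiff := h.contMDiff.comp contMDiff_boundary_val
  injective_mfderiv x := by
    rw [show (fun x : I.boundary X => f x) = f ∘ Subtype.val from rfl,
      mfderiv_comp x (h.contMDiff.mdifferentiableAt (by simp))
        (contMDiff_boundary_val.mdifferentiableAt (by simp))]
    exact (h.injective_mfderiv x).comp (injective_mfderiv_boundary_val x)
  isEmbedding := h.isEmbedding.comp IsEmbedding.subtypeVal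

end BoundaryFunction

/-! ### Neat embeddings in a half-space -/

section HalfSpace

lemma mem_boundary_euclideanHalfSpace {m : ℕ} (y : EuclideanHalfSpace (m + 1)) :
    y ∈ (𝓡∂ (m + 1)).boundary (EuclideanHalfSpace (m + 1)) ↔ y.1 0 = 0 := by
  have h0 : HalfSpaceModel.form (𝓡∂ (m + 1)) ≠ 0 := by
    intro h
    have h1 := congrArg (fun L : EuclideanSpace ℝ (Fin (m + 1)) →L[ℝ] ℝ =>
      L (EuclideanSpace.single 0 1)) h
    have h2 : (EuclideanSpace.single (0 : Fin (m + 1)) (1 : ℝ) : EuclideanSpace ℝ (Fin (m + 1))) 0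
      = 0 := h1
    simp at h2
  exact mem_boundary_iff_form h0 (chart_mem_atlas (EuclideanHalfSpace (m + 1)) y) (mem_univ y)

lemma sup_ker_eq_top {V : Type*} [AddCommGroup V] [Module ℝ V] {R : Submodule ℝ V} {ℓ : V →ₗ[ℝ] ℝ}
    {v : V} (hv : v ∈ R) (hℓ : ℓ v ≠ 0) : R ⊔ LinearMap.ker ℓ = ⊤ := by
  rw [eq_top_iff]
  intro w _
  rw [← sub_add_cancel w ((ℓ w / ℓ v) • v), add_comm]
  refine Submodule.add_mem_sup (R.smul_mem _ hv) ?_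
  rw [LinearMap.mem_ker, map_sub, map_smul, smul_eq_mul, div_mul_cancel₀ _ hℓ, sub_self]

variable {E : Type*} [NormedAddCommGroup E] [NormedSpace ℝ E]
  {H : Type*} [TopologicalSpace H] {I : ModelWithCorners ℝ E H}
  {X : Type*} [TopologicalSpace X] [ChartedSpace H X]

lemma SmoothEmb.neatEmb {m : ℕ} {f : X → EuclideanHalfSpace (m + 1)}
    (h : SmoothEmb I (𝓡∂ (m + 1)) f) (hb : ∀ x, (f x).1 0 = 0 ↔ x ∈ I.boundary X)
    (ht : ∀ x ∈ I.boundary X, ∃ w : E,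
      (show E →L[ℝ] ℝ from mfderiv I 𝓘(ℝ, ℝ) (fun x => (f x).1 0) x) w ≠ 0) :
    NeatEmb I (𝓡∂ (m + 1)) f where
  toSmoothEmb := h
  preimage_boundary := by
    ext x
    exact (mem_boundary_euclideanHalfSpace (f x)).trans (hb x)
  transverse x hx := by
    obtain ⟨w, hw⟩ := ht x hx
    refine sup_ker_eq_top (v := (show E →L[ℝ] EuclideanSpace ℝ (Fin (m + 1)) from
      mfderiv I (𝓡∂ (m + 1)) f x) w) ⟨w, rfl⟩ ?_
    have h1 := mfderiv_clm_comp_apply (contMDiff_modelSpace_iff.1 h.contMDiff)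
      (HalfSpaceModel.form (𝓡∂ (m + 1))) x w
    rw [← mfderiv_modelSpace (h.contMDiff.mdifferentiableAt (by simp))] at h1
    exact fun h2 => hw (h1.trans h2)

end HalfSpace

section Assembly

/-- The inclusion `y ↦ (0, y)` as a linear map. -/
noncomputable def consZero (m : ℕ) : EuclideanSpace ℝ (Fin m) →L[ℝ] EuclideanSpace ℝ (Fin (m + 1)) :=
  LinearMap.toContinuousLinearMap
    { toFun := fun y => WithLp.toLp 2 (Fin.cons 0 y)
      map_add' := fun x y => by
        ext i
        refine Fin.cases ?_ (fun j => ?_) i <;> simp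
      map_smul' := fun a y => by
        ext i
        refine Fin.cases ?_ (fun j => ?_) i <;> simp }

/-- The projection `(t, y) ↦ y` as a linear map. -/
noncomputable def euclideanTail (m : ℕ) : EuclideanSpace ℝ (Fin (m + 1)) →L[ℝ] EuclideanSpace ℝ (Fin m) :=
  LinearMap.toContinuousLinearMap
    { toFun := fun y => WithLp.toLp 2 (fun i => y i.succ)
      map_add' := fun _ _ => rfl
      map_smul' := fun _ _ => rfl }

variable {W : Type*} [NormedAddCommGroup W] [NormedSpace ℝ W]

/-- The map `(t, w) ↦ (t, L w)` to a Euclidean space. -/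
noncomputable def consClm {m : ℕ} (L : W →L[ℝ] EuclideanSpace ℝ (Fin m)) :
    ℝ × W →L[ℝ] EuclideanSpace ℝ (Fin (m + 1)) :=
  (ContinuousLinearMap.toSpanSingleton ℝ (EuclideanSpace.single 0 1)).coprod ((consZero m).comp L)

lemma consClm_apply_zero {m : ℕ} (L : W →L[ℝ] EuclideanSpace ℝ (Fin m)) (p : ℝ × W) :
    consClm L p 0 = p.1 := by
  simp [consClm, consZero]

lemma euclideanTail_consClm {m : ℕ} (L : W →L[ℝ] EuclideanSpace ℝ (Fin m)) (p : ℝ × W) :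
    euclideanTail m (consClm L p) = L p.2 := by
  ext i
  show consClm L p i.succ = _
  simp [consClm, consZero]

lemma consClm_zero_left {m : ℕ} (L : W →L[ℝ] EuclideanSpace ℝ (Fin m)) (w : W) :
    consClm L (0, w) = consZero m (L w) := by
  simp [consClm]

end Assembly

lemma ManifoldOver.exists_finite_cutoff {E : Type*} [NormedAddCommGroup E] [NormedSpace ℝ E]
    {H : Type*} [TopologicalSpace H] {I : ModelWithCorners ℝ E H}
    {X : Type*} [TopologicalSpace X] [ChartedSpace H X]
    {B : Type*} [TopologicalSpace B] [CompactSpace B] [T2Space B]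
    {T : Type*} [TopologicalSpace T] (𝓧 : ManifoldOver I X B T) :
    ∃ (s : Finset B) (e : s → Trivialization X 𝓧.proj) (c : s → B → ℝ),
      (∀ i, e i ∈ 𝓧.atlas) ∧ (∀ i, Continuous (c i)) ∧ (∀ i, tsupport (c i) ⊆ (e i).baseSet) ∧
      (∀ i b, 0 ≤ c i b) ∧ ∀ b, ∃ i, c i b ≠ 0 := by
  choose e he hb using 𝓧.exists_mem_baseSet
  obtain ⟨s, -, hs⟩ := isCompact_univ.elim_nhds_subcover (fun b => (e b).baseSet)
    (fun b _ => (e b).open_baseSet.mem_nhds (hb b))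
  obtain ⟨c, hc⟩ := PartitionOfUnity.exists_isSubordinate isClosed_univ
    (fun i : s => (e i).baseSet) (fun i => (e i).open_baseSet) (fun b hb => by
      obtain ⟨i, hi, hbi⟩ := mem_iUnion₂.1 (hs hb)
      exact mem_iUnion.2 ⟨⟨i, hi⟩, hbi⟩)
  refine ⟨s, fun i => e i, fun i => c i, fun i => he i, fun i => (c i).continuous, hc,
    fun i b => c.nonneg i b, fun b => ?_⟩
  obtain ⟨i, hi⟩ := c.exists_pos (mem_univ b)
  exact ⟨i, hi.ne'⟩

open ManifoldOver in
/-- A neat embedding over the base from an embedding of the fibre and a function that defines the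
boundary of the fibre. -/
theorem ManifoldOver.exists_neatEmbeddingOver
    {E : Type*} [NormedAddCommGroup E] [NormedSpace ℝ E] [FiniteDimensional ℝ E]
    {H : Type*} [TopologicalSpace H] {I : ModelWithCorners ℝ E H} [HalfSpaceModel I]
    {X : Type*} [TopologicalSpace X] [ChartedSpace H X] [IsManifold I ∞ X]
    {B : Type*} [TopologicalSpace B] [CompactSpace B] [T2Space B]
    {T : Type*} [TopologicalSpace T] (𝓧 : ManifoldOver I X B T)
    {W : Type*} [NormedAddCommGroup W] [NormedSpace ℝ W] [FiniteDimensional ℝ W]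
    {f : X → W} (hf : SmoothEmb I 𝓘(ℝ, W) f) {ρ : X → ℝ} (hρ : ContMDiff I 𝓘(ℝ, ℝ) ∞ ρ)
    (hρ0 : ∀ x, 0 ≤ ρ x) (hρb : ∀ x, ρ x = 0 ↔ x ∈ I.boundary X)
    (hρd : ∀ x ∈ I.boundary X, ∃ w : E, (show E →L[ℝ] ℝ from mfderiv I 𝓘(ℝ, ℝ) ρ x) w ≠ 0) :
    ∃ (m : ℕ) (h : T → B × EuclideanHalfSpace (m + 1)),
      𝓧.IsNeatEmbeddingOver (𝓡∂ (m + 1)) h ∧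
      ∃ h₀ : 𝓧.boundaryTotal → B × EuclideanSpace ℝ (Fin m),
        𝓧.boundary.IsEmbeddingOver (𝓡 m) h₀ ∧
        ∀ z : 𝓧.boundaryTotal, h z = ((h₀ z).1, halfSpaceBoundary m (h₀ z).2) := by
  classical
  have : LocallyCompactSpace X := Manifold.locallyCompact_of_finiteDimensional I
  have : LocallyCompactSpace (I.boundary X) :=
    Manifold.locallyCompact_of_finiteDimensional 𝓘(ℝ, BoundaryModel I)
  obtain ⟨s, e, c, he, hc, hcs, hc0, hcne⟩ := 𝓧.exists_finite_cutoff
  have hmem : ∀ i b, c i b ≠ 0 → b ∈ (e i).baseSet := fun i b hb => hcs i (subset_tsupport _ hb)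
  obtain ⟨m, ⟨Θ⟩⟩ : ∃ m, Nonempty ((s → W) ≃L[ℝ] EuclideanSpace ℝ (Fin m)) :=
    ⟨_, ⟨ContinuousLinearEquiv.ofFinrankEq finrank_euclideanSpace_fin.symm⟩⟩
  let A : s → W →L[ℝ] EuclideanSpace ℝ (Fin m) := fun i =>
    (Θ : (s → W) →L[ℝ] EuclideanSpace ℝ (Fin m)).comp (ContinuousLinearMap.single ℝ (fun _ => W) i)
  let P : s → EuclideanSpace ℝ (Fin m) →L[ℝ] W := fun i =>
    (ContinuousLinearMap.proj i).comp (Θ.symm : EuclideanSpace ℝ (Fin m) →L[ℝ] (s → W))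
  have hPA : ∀ i w, P i (A i w) = w := fun i w => by simp [P, A]
  have hPA' : ∀ i j w, i ≠ j → P i (A j w) = 0 := fun i j w hij => by simp [P, A, hij]
  let F : X → ℝ × W := fun x => (ρ x, f x)
  let u : T → EuclideanSpace ℝ (Fin (m + 1)) := fun z =>
    ∑ i, c i (𝓧.proj z) • consClm (A i) (F (e i z).2)
  have hu : ∀ z, u z 0 = ∑ i, c i (𝓧.proj z) * ρ (e i z).2 := fun z => by
    simp [u, consClm_apply_zero, F]
  have hterm : ∀ i z, 0 ≤ c i (𝓧.proj z) * ρ (e i z).2 := fun i z =>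
    mul_nonneg (hc0 _ _) (hρ0 _)
  let h : T → B × EuclideanHalfSpace (m + 1) := fun z =>
    (𝓧.proj z, ⟨u z, (Finset.sum_nonneg fun i _ => hterm i z).trans_eq (hu z).symm⟩)
  have hemb : 𝓧.IsEmbeddingOver (𝓡∂ (m + 1)) h :=
    isEmbeddingOver_of_cutoff (f := F) (A := fun i => consClm (A i))
      (P := fun i => (P i).comp (euclideanTail m)) (Q := ContinuousLinearMap.snd ℝ ℝ W)
      he hc hcs hcne (hρ.prodMk_space hf.contMDiff)
      (fun i w => (congrArg (P i) (euclideanTail_consClm _ _)).trans (hPA i _))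
      (fun i j w hij => (congrArg (P i) (euclideanTail_consClm _ _)).trans (hPA' i j _ hij))
      hf (fun _ => rfl) (fun _ => rfl)
  let h₀ : 𝓧.boundaryTotal → B × EuclideanSpace ℝ (Fin m) := fun z =>
    (𝓧.proj z, ∑ i, c i (𝓧.proj z) • A i (f (e i z).2))
  have hf₀ := hf.comp_boundary_val
  have hemb₀ : 𝓧.boundary.IsEmbeddingOver (𝓡 m) h₀ := by
    refine isEmbeddingOver_of_cutoff (𝓧 := 𝓧.boundary)
      (e := fun i => boundaryTrivialization 𝓧 (e i) (he i)) (f := fun x : I.boundary X => f x)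
      (A := A) (P := P) (Q := ContinuousLinearMap.id ℝ W) (fun i => ⟨e i, he i, rfl⟩) hc hcs hcne
      hf₀.contMDiff hPA hPA' hf₀ (fun _ => rfl) fun z => Finset.sum_congr rfl fun i _ => ?_
    by_cases hi : c i (𝓧.proj z) = 0
    · show c i (𝓧.proj z) • _ = c i (𝓧.proj z) • _
      rw [hi, zero_smul, zero_smul]
    · exact congrArg (fun x => c i (𝓧.proj z) • A i (f x))
        (boundaryTrivialization_apply_snd (he i) z (hmem i _ hi)).symm
  refine ⟨m, h, ⟨hemb, fun e' he' b hb => (hemb.fibre e' he' b hb).neatEmb ?_ ?_⟩, h₀, hemb₀,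
    fun z => Prod.ext rfl (Subtype.ext ?_)⟩
  · intro x
    have hx : (h (e'.toOpenPartialHomeomorph.symm (b, x))).2.1 0 =
        ∑ i, c i b * ρ (e i (e'.toOpenPartialHomeomorph.symm (b, x))).2 := by
      refine (hu _).trans ?_
      rw [e'.proj_symm_apply' hb]
    have hg : ∀ i, c i b ≠ 0 → (ρ (e i (e'.toOpenPartialHomeomorph.symm (b, x))).2 = 0 ↔
        x ∈ I.boundary X) := by
      intro i hi
      obtain ⟨g, hg⟩ := exists_diffeomorph he' (he i) hb (hmem i b hi)
      rw [hg, hρb]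
      exact Set.ext_iff.1 (g.preimage_boundary (by simp)) x
    rw [hx, Finset.sum_eq_zero_iff_of_nonneg fun i _ => mul_nonneg (hc0 i b) (hρ0 _)]
    constructor
    · intro hall
      obtain ⟨i, hi⟩ := hcne b
      exact (hg i hi).1 ((mul_eq_zero.1 (hall i (Finset.mem_univ i))).resolve_left hi)
    · intro hxb i _
      by_cases hi : c i b = 0
      · rw [hi, zero_mul]
      · rw [(hg i hi).2 hxb, mul_zero]
  · intro x hx
    obtain ⟨i, hi⟩ := hcne b
    obtain ⟨g, hg⟩ := exists_diffeomorph he' (he i) hb (hmem i b hi)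
    have hr : ∀ x, (h (e'.toOpenPartialHomeomorph.symm (b, x))).2.1 0 =
        ∑ i, c i b * ρ (e i (e'.toOpenPartialHomeomorph.symm (b, x))).2 := fun x => by
      refine (hu _).trans ?_
      rw [e'.proj_symm_apply' hb]
    have hrs : ContMDiff I 𝓘(ℝ, ℝ) ∞
        (fun x => (h (e'.toOpenPartialHomeomorph.symm (b, x))).2.1 0) :=
      (EuclideanSpace.proj (𝕜 := ℝ) (0 : Fin (m + 1))).contMDiff.comp
        (contMDiff_modelSpace_iff.1 (hemb.fibre e' he' b hb).contMDiff)
    have hgx : g x ∈ I.boundary X := by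
      have : x ∈ g ⁻¹' I.boundary X := by rwa [g.preimage_boundary (by simp)]
      exact this
    have hρg : ContMDiff I 𝓘(ℝ, ℝ) ∞ (fun x => ρ (g x)) := hρ.comp g.contMDiff
    have hsm : ContMDiff I 𝓘(ℝ, ℝ) ∞ (fun x => (c i b • ContinuousLinearMap.id ℝ ℝ) (ρ (g x))) :=
      (c i b • ContinuousLinearMap.id ℝ ℝ).contMDiff.comp hρg
    refine exists_mfderiv_ne_zero_of_le (hrs.mdifferentiableAt (by simp))
      (hsm.mdifferentiableAt (by simp)) (fun y => ?_) (fun y => mul_nonneg (hc0 i b) (hρ0 _)) ?_ ?_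
    · rw [hr]
      refine le_of_eq_of_le ?_ (Finset.single_le_sum (fun j _ => mul_nonneg (hc0 j b) (hρ0 _))
        (Finset.mem_univ i))
      rw [hg]
      rfl
    · rw [hr]
      refine Finset.sum_eq_zero fun j _ => ?_
      by_cases hj : c j b = 0
      · rw [hj, zero_mul]
      · obtain ⟨g', hg'⟩ := exists_diffeomorph he' (he j) hb (hmem j b hj)
        have : x ∈ g' ⁻¹' I.boundary X := by rwa [g'.preimage_boundary (by simp)]
        rw [hg', (hρb _).2 this, mul_zero]
    · obtain ⟨w, hw⟩ := hρd (g x) hgx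
      obtain ⟨v, hv⟩ := (mfderiv_diffeomorph_bijective g x).2 w
      refine ⟨v, fun h0 => ?_⟩
      have h1 := (mfderiv_clm_comp_apply hρg (c i b • ContinuousLinearMap.id ℝ ℝ) x v).symm.trans h0
      have h2 := (mul_eq_zero.1 h1).resolve_left hi
      have h3 := mfderiv_comp x (hρ.mdifferentiableAt (x := g x) (by simp))
        (g.contMDiff.mdifferentiableAt (x := x) (by simp))
      refine hw ?_
      rw [← hv]
      exact (congrArg (fun M : E →L[ℝ] ℝ => M v) h3).symm.trans h2
  · show u z = consZero m (∑ i, c i (𝓧.proj z) • A i (f (e i z).2))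
    rw [map_sum]
    refine Finset.sum_congr rfl fun i _ => ?_
    rw [map_smul]
    by_cases hi : c i (𝓧.proj z) = 0
    · rw [hi, zero_smul, zero_smul]
    · rw [← consClm_zero_left]
      have : ρ (e i z).2 = 0 := (hρb _).2 ((mem_boundaryTotal_iff (he i) (hmem i _ hi)).1 z.2)
      simp only [F, this]

/-- A manifold over a compact Hausdorff base has a neat embedding over the base in a half-space,
which restricts to an embedding over the base of the boundary over the base in the boundary of the
half-space. -/
theorem mainTheorem9
    {E : Type*} [NormedAddCommGroup E] [NormedSpace ℝ E] [FiniteDimensional ℝ E]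
    {H : Type*} [TopologicalSpace H] {I : ModelWithCorners ℝ E H} [HalfSpaceModel I]
    {X : Type*} [TopologicalSpace X] [ChartedSpace H X] [IsManifold I ∞ X]
    [T2Space X] [SecondCountableTopology X]
    {B : Type*} [TopologicalSpace B] [CompactSpace B] [T2Space B]
    {T : Type*} [TopologicalSpace T] (𝓧 : ManifoldOver I X B T) :
    ∃ (m : ℕ) (h : T → B × EuclideanHalfSpace (m + 1)),
      𝓧.IsNeatEmbeddingOver (𝓡∂ (m + 1)) h ∧
      ∃ h₀ : 𝓧.boundaryTotal → B × EuclideanSpace ℝ (Fin m),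
        𝓧.boundary.IsEmbeddingOver (𝓡 m) h₀ ∧
        ∀ z : 𝓧.boundaryTotal, h z = ((h₀ z).1, halfSpaceBoundary m (h₀ z).2) := by
  obtain ⟨d, f, hf⟩ := exists_smoothEmb (I := I) (X := X)
  have : LocallyCompactSpace X := Manifold.locallyCompact_of_finiteDimensional I
  obtain ⟨ρ, hρ, hρ0, hρb, hρd⟩ := exists_boundary_defining_function I X
  exact 𝓧.exists_neatEmbeddingOver hf hρ hρ0 hρb hρd
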